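/- Graphs are finite and undirected, and may have loops and multiple edges. For a graph $G=(V,E)$ let $P_G(q)=\sum_{A\subseteq E}(-1)^{|A|}q^{k(A)}$ be its chromatic polynomial, where $k(A)$ is the number of connected components of $(V,A)$, isolated vertices included. A graph is 2-degenerate if every nonempty subgraph has a vertex of degree at most 2 in that subgraph. For an integer $s\ge 2$ put $$C_s(q)=\frac{(q-1)^s+(q-1)(-1)^s}{q},\qquad Q_s=\{q\in\mathbb C:\ |(q-1)^s+(q-1)(-1)^s|>|(q-1)^s-(-1)^s|\}.$$ (Note that $0\notin Q_s$, and that $C_s$ has no zero in $Q_s$.) Theorem B.1. Let $G$ be a loopless graph, and let $s$ be an integer $\ge 2$. Then there exist 2-degenerate (hence 3-colorable) graphs $\{G'(p)\}_{p=1}^\infty$ and an integer $k\ge 0$ such that (a) $\lim_{p\to\infty} C_s(q)^{-kp}\,P_{G'(p)}(q)=P_G(q)$ uniformly on compact subsets of $Q_s$. (b) If $G$ is connected, then so are the $G'(p)$. (c) If $s$ is even and $G$ is bipartite, then so are the $G'(p)$. (d) If $G$ is embeddable on a surface $S$ (a Hausdorff 2-dimensional topological manifold without boundary, compact or not), then so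 are the $G'(p)$. Here the $G'(p)$ do not depend on $S$. In particular: (i) If $q_0\in Q_s$ is a zero of $P_G$, then for all $\epsilon>0$ and all sufficiently large $p$ (depending on $\epsilon$), $P_{G'(p)}$ has a zero in the disc $|q-q_0|<\epsilon$. (ii) If $q_0\in Q_s\cap\mathbb R$ is a zero of $P_G$ of odd multiplicity, then for all $\epsilon>0$ and all sufficiently large $p$ (depending on $\epsilon$), $P_{G'(p)}$ has a zero in the interval $(q_0-\epsilon,q_0+\epsilon)$. -/

import Mathlib

open scoped Graph

/-! Finite undirected graphs, possibly with loops and multiple edges, are Mathlib's `Graph α β` with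
`V(G)` and `E(G)` finite. -/

universe u v w

namespace Graph

/-- The number `k(A)` of connected components (isolated vertices included) of the spanning subgraph
of `G` whose edges are those in `A`. -/
noncomputable def numComponents {α : Type u} {β : Type v} (G : Graph α β) (A : Set β) : ℕ :=
  Nat.card (G.restrict A).toSimpleGraph.ConnectedComponent

/-- The chromatic polynomial of a finite graph,
`P_G(q) = ∑_{A ⊆ E(G)} (-1)^{|A|} q^{k(A)}`. -/
noncomputable def chromaticPolynomial {α : Type u} {β : Type v} (G : Graph α β) : Polynomial ℤ :=
  ∑ᶠ A ∈ E(G).powerset, (-1) ^ A.ncard * Polynomial.X ^ G.numComponents A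

/-- The degree of a vertex: the number of edges at `x`, a loop being counted twice. -/
noncomputable def degree {α : Type u} {β : Type v} (G : Graph α β) (x : α) : ℕ∞ :=
  {e | G.IsNonloopAt e x}.encard + 2 * {e | G.IsLoopAt e x}.encard

/-- The minimum degree of a (nonempty) graph. -/
noncomputable def minDegree {α : Type u} {β : Type v} (G : Graph α β) : ℕ∞ :=
  ⨅ x ∈ V(G), G.degree x

/-- The degeneracy number: the maximum of the minimum degree over all (nonempty) subgraphs. -/
noncomputable def degeneracyNumber {α : Type u} {β : Type v} (G : Graph α β) : ℕ∞ :=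
  ⨆ (H : Graph α β) (_ : H ≤ G) (_ : V(H).Nonempty), H.minDegree

/-- A graph is `k`-degenerate if its degeneracy number is at most `k`. -/
def IsDegenerate {α : Type u} {β : Type v} (G : Graph α β) (k : ℕ) : Prop :=
  G.degeneracyNumber ≤ k

/-- `G` has a proper vertex colouring with `n` colours. -/
def Colorable {α : Type u} {β : Type v} (G : Graph α β) (n : ℕ) : Prop :=
  ∃ c : V(G) → Fin n, ∀ x y : V(G), G.Adj x y → c x ≠ c y

/-- A graph is bipartite if its vertices can be split into two classes such that every edge joins
the two classes. -/
def IsBipartite {α : Type u} {β : Type v} (G : Graph α β) : Prop :=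
  G.Colorable 2

/-- A graph is connected if it is nonempty and any two vertices are joined by a walk. -/
def IsConnected {α : Type u} {β : Type v} (G : Graph α β) : Prop :=
  G.toSimpleGraph.Connected

/-- `G` can be drawn on the space `S` without crossings: distinct vertices are distinct points, each
edge is a continuous arc joining its ends (a closed curve for a loop), no arc passes through a
vertex at an interior time, and no point is passed twice by interior points of arcs. -/
def EmbeddableOn {α : Type u} {β : Type v} (G : Graph α β) (S : Type w) [TopologicalSpace S] :
    Prop :=
  ∃ (pt : V(G) → S) (arc : E(G) → C(unitInterval, S)),
    Function.Injective pt ∧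
    (∀ (e : E(G)) (x y : V(G)), G.IsLink e x y → s(arc e 0, arc e 1) = s(pt x, pt y)) ∧
    (∀ (e : E(G)), ∀ t ∈ Set.Ioo (0 : unitInterval) 1, ∀ x : V(G), arc e t ≠ pt x) ∧
    (∀ (e f : E(G)), ∀ t ∈ Set.Ioo (0 : unitInterval) 1, ∀ t' ∈ Set.Ioo (0 : unitInterval) 1,
      arc e t = arc f t' → e = f ∧ t = t')

end Graph

/-- `C_s(q) = ((q-1)^s + (q-1)(-1)^s) / q`, for `q ≠ 0`. -/
noncomputable def cycleFactor (s : ℕ) (q : ℂ) : ℂ :=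
  ((q - 1) ^ s + (q - 1) * (-1) ^ s) / q

/-- The set `Q_s` of all `q` with `|(q-1)^s + (q-1)(-1)^s| > |(q-1)^s - (-1)^s|`; it does not
contain `0`, and `C_s` has no zero on it. -/
def regionQ (s : ℕ) : Set ℂ :=
  {q | ‖(q - 1) ^ s - (-1) ^ s‖ < ‖(q - 1) ^ s + (q - 1) * (-1) ^ s‖}

/-!
Replace every edge `e` from `a` to `b` by `p` parallel paths of length `s` from `a` to a new vertex
`m`, followed by one edge from `m` to `b`. For `q ∈ ℕ` colours, a path of length `s` has
`closedWalkCount s q = C_s(q)` colourings if its ends agree and `openWalkCount s q` if they differ.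
Summing over the colour of `m`, the gadget has the weight of a single Potts edge: up to the factor
`C_s(q) ^ p` it is `(q - 1) r ^ p` if the ends of `e` agree and `1 + (q - 2) r ^ p` if they differ,
with `r = openWalkCount s q / closedWalkCount s q`. In the Fortuin–Kasteleyn form this is a
polynomial identity, hence true for complex `q`, and `Q_s` is exactly the set where `‖r‖ < 1`; so
the limit is the chromatic polynomial of `G`. Hurwitz' theorem gives (i), and a sign change gives
(ii).

For (d), a small disc around every vertex lies in a chart. An arc is cut where it leaves the disc
at its first end for the last time and where it then enters the disc at its second end, and the
cut ends are joined to the centres by radii. In a thin sector next to the radius at `a` there is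
room for the `p` paths, while `m` is put on the radius itself.
-/

section ClusterExpansion

variable {α : Type u} {β : Type v} {ι ε κ R : Type*}

/-- The Fortuin–Kasteleyn sum `∑_{A ⊆ E(G)} z^{|E(G) \ A|} w^{|A|} q^{k(A)}`: the partition function
of the `q`-state Potts model in which every edge has weight `z` if its ends differ and `z + w` if
they agree. It is the chromatic polynomial for `z = 1`, `w = -1`. -/
noncomputable def clusterSum [CommSemiring R] (G : Graph α β) (z w q : R) : R :=
  ∑ᶠ A ∈ E(G).powerset, z ^ (E(G) \ A).ncard * w ^ A.ncard * q ^ G.numComponents A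

theorem chromaticPolynomial_eq_clusterSum (G : Graph α β) :
    G.chromaticPolynomial = clusterSum G 1 (-1) Polynomial.X := by
  simp [Graph.chromaticPolynomial, clusterSum]

theorem map_clusterSum {S : Type*} [CommSemiring R] [CommSemiring S] {G : Graph α β}
    (hE : E(G).Finite) (f : R →+* S) (z w q : R) :
    f (clusterSum G z w q) = clusterSum G (f z) (f w) (f q) := by
  have hpow : E(G).powerset.Finite := hE.finite_subsets
  exact ((f : R →+ S).map_finsum_mem _ hpow).trans (finsum_mem_congr rfl fun A _ ↦ by simp)

theorem aeval_chromaticPolynomial [CommRing R] {G : Graph α β} (hE : E(G).Finite) (q : R) :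
    Polynomial.aeval q G.chromaticPolynomial = clusterSum G 1 (-1) q := by
  rw [chromaticPolynomial_eq_clusterSum]
  simpa using map_clusterSum hE (Polynomial.aeval (R := ℤ) q).toRingHom 1 (-1) Polynomial.X

theorem clusterSum_mul_mul [CommSemiring R] {G : Graph α β} (hE : E(G).Finite) (c z w q : R) :
    clusterSum G (c * z) (c * w) q = c ^ E(G).ncard * clusterSum G z w q := by
  have hpow : E(G).powerset.Finite := hE.finite_subsets
  rw [clusterSum, clusterSum, mul_finsum_mem' _ _ hpow]
  refine finsum_mem_congr rfl fun A hA ↦ ?_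
  rw [← Set.ncard_sdiff_add_ncard_of_subset hA hE, mul_pow, mul_pow, pow_add]
  ring

/-- An identification of `G` with the graph on the vertices `ι` with the edges `ε` in which `e`
joins `a e` to `b e`. -/
structure Presentation (G : Graph α β) (a b : ε → ι) where
  /-- The vertex labelled by an element of `ι`. -/
  vert : ι ≃ V(G)
  /-- The edge labelled by an element of `ε`. -/
  edge : ε ≃ E(G)
  isLink (e : ε) : G.IsLink (edge e) (vert (a e)) (vert (b e))

theorem exists_presentation (G : Graph α β) :
    ∃ a b : E(G) → V(G), Nonempty (Presentation G a b) := by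
  choose a b hab using fun e : E(G) ↦ G.exists_isLink_of_mem_edgeSet e.2
  exact ⟨fun e ↦ ⟨a e, (hab e).left_mem⟩, fun e ↦ ⟨b e, (hab e).right_mem⟩,
    ⟨Equiv.refl _, Equiv.refl _, hab⟩⟩

/-- Colourings of the connected components of `H` are the same as colourings of the vertices that
are constant along edges. -/
def connectedComponentArrowEquiv {V : Type*} (H : SimpleGraph V) (κ : Type*) :
    (H.ConnectedComponent → κ) ≃ {σ : V → κ // ∀ x y, H.Adj x y → σ x = σ y} where
  toFun f := ⟨f ∘ H.connectedComponentMk, fun _ _ h ↦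
    congrArg f (SimpleGraph.ConnectedComponent.connectedComponentMk_eq_of_adj h)⟩
  invFun σ := SimpleGraph.ConnectedComponent.lift σ.1 fun _ _ p hp ↦ by
    clear hp
    induction p with
    | nil => rfl
    | cons h _ ih => exact (σ.2 _ _ h).trans ih
  left_inv f := by
    ext K
    induction K using SimpleGraph.ConnectedComponent.ind
    rfl
  right_inv _ := rfl

namespace Presentation

variable {G : Graph α β} {a b : ε → ι}

theorem isLink_iff (P : Presentation G a b) {e : ε} {x y : ι} :
    G.IsLink (P.edge e) (P.vert x) (P.vert y) ↔ a e = x ∧ b e = y ∨ a e = y ∧ b e = x := by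
  rw [(P.isLink e).isLink_iff]
  simp [Subtype.val_inj]

/-- The edges of `G` labelled by the elements of `A`. -/
def edgeImage (P : Presentation G a b) (A : Set ε) : Set β :=
  (fun e ↦ (P.edge e : β)) '' A

theorem edge_val_injective (P : Presentation G a b) :
    Function.Injective fun e ↦ (P.edge e : β) :=
  Subtype.val_injective.comp P.edge.injective

theorem bijOn_edgeImage (P : Presentation G a b) [Finite ε] :
    Set.BijOn (fun A : Finset ε ↦ P.edgeImage A) Set.univ E(G).powerset := by
  classical
  have := Fintype.ofFinite ε
  refine ⟨?_, fun A _ B _ h ↦ ?_, fun B hB ↦ ?_⟩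
  · rintro A - _ ⟨e, -, rfl⟩
    exact (P.edge e).2
  · exact Finset.coe_injective (P.edge_val_injective.image_injective h)
  · refine ⟨Finset.univ.filter fun e ↦ (P.edge e : β) ∈ B, trivial,
      Set.ext fun x ↦ ⟨?_, fun hx ↦ ?_⟩⟩
    · rintro ⟨e, he, rfl⟩
      simpa using he
    · exact ⟨P.edge.symm ⟨x, hB hx⟩, by simpa using hx, by simp⟩

theorem edgeSet_diff_edgeImage (P : Presentation G a b) (A : Set ε) :
    E(G) \ P.edgeImage A = P.edgeImage Aᶜ := by
  have huniv : E(G) = P.edgeImage Set.univ := by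
    rw [edgeImage, ← Set.image_image, Set.image_univ_of_surjective P.edge.surjective,
      Set.image_univ, Subtype.range_coe]
  calc E(G) \ P.edgeImage A
    _ = P.edgeImage Set.univ \ P.edgeImage A := congrArg (· \ P.edgeImage A) huniv
    _ = P.edgeImage (Set.univ \ A) := (Set.image_sdiff P.edge_val_injective _ _).symm
    _ = P.edgeImage Aᶜ := by rw [Set.compl_eq_univ_sdiff]

theorem ncard_edgeImage (P : Presentation G a b) (A : Finset ε) :
    (P.edgeImage A).ncard = A.card := by
  rw [edgeImage, Set.ncard_image_of_injective _ P.edge_val_injective, Set.ncard_coe_finset]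

theorem clusterSum_eq_sum [CommSemiring R] [Fintype ε] [DecidableEq ε] (P : Presentation G a b)
    (z w q : R) :
    clusterSum G z w q =
      ∑ A : Finset ε, z ^ Aᶜ.card * w ^ A.card * q ^ G.numComponents (P.edgeImage A) := by
  rw [← finsum_eq_sum_of_fintype, ← finsum_mem_univ, clusterSum]
  symm
  refine finsum_mem_eq_of_bijOn _ P.bijOn_edgeImage fun A _ ↦ ?_
  rw [P.edgeSet_diff_edgeImage, ← Finset.coe_compl, P.ncard_edgeImage, P.ncard_edgeImage]

theorem forall_restrict_adj_iff (P : Presentation G a b) (A : Set ε) (σ : V(G) → κ) :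
    (∀ x y, (G.restrict (P.edgeImage A)).toSimpleGraph.Adj x y → σ x = σ y) ↔
      ∀ e ∈ A, σ (P.vert (a e)) = σ (P.vert (b e)) := by
  refine ⟨fun h e he ↦ ?_, fun h x y hxy ↦ ?_⟩
  · by_cases heq : P.vert (a e) = P.vert (b e)
    · rw [heq]
    · exact h _ _ ⟨heq, P.edge e, ⟨e, he, rfl⟩, P.isLink e⟩
  · obtain ⟨-, -, ⟨e, he, rfl⟩, hlink⟩ := hxy
    obtain ⟨x, rfl⟩ := P.vert.surjective x
    obtain ⟨y, rfl⟩ := P.vert.surjective y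
    obtain ⟨rfl, rfl⟩ | ⟨rfl, rfl⟩ := P.isLink_iff.1 hlink
    exacts [h e he, (h e he).symm]

theorem card_constant_on (P : Presentation G a b) [Finite ι] (A : Set ε) :
    Nat.card {σ : ι → κ // ∀ e ∈ A, σ (a e) = σ (b e)} =
      Nat.card κ ^ G.numComponents (P.edgeImage A) := by
  let H := (G.restrict (P.edgeImage A)).toSimpleGraph
  have : Finite V(G) := Finite.of_equiv _ P.vert
  have : Finite H.ConnectedComponent := Quot.finite (α := V(G)) _
  have e : {σ : ι → κ // ∀ e ∈ A, σ (a e) = σ (b e)} ≃ (H.ConnectedComponent → κ) :=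
    ((P.vert.arrowCongr (Equiv.refl κ)).subtypeEquiv fun σ ↦
      .trans (by simp) (P.forall_restrict_adj_iff A _).symm).trans
        (connectedComponentArrowEquiv H κ).symm
  rw [Nat.card_congr e, Nat.card_fun]
  rfl

-- Expand each factor as `z` plus the weight `w` of an edge with equal ends.
theorem clusterSum_card_eq_sum_prod [CommSemiring R] [Fintype ε] [Fintype ι] [Fintype κ]
    [DecidableEq ι] [DecidableEq κ] (P : Presentation G a b) (z w : R) :
    clusterSum G z w (Fintype.card κ : R) =
      ∑ σ : ι → κ, ∏ e, if σ (a e) = σ (b e) then z + w else z := by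
  classical
  have hprod (σ : ι → κ) (A : Finset ε) :
      (∏ e ∈ A, if σ (a e) = σ (b e) then w else 0) =
        w ^ A.card * if ∀ e ∈ A, σ (a e) = σ (b e) then 1 else 0 := by
    rw [Finset.prod_ite_zero]
    simp
  have hcount (A : Finset ε) :
      ∑ σ : ι → κ, (if ∀ e ∈ A, σ (a e) = σ (b e) then (1 : R) else 0) =
        (Fintype.card κ : R) ^ G.numComponents (P.edgeImage A) := by
    rw [Finset.sum_boole, ← Fintype.card_subtype, ← Nat.card_eq_fintype_card,
      ← Nat.card_eq_fintype_card (α := κ), ← Nat.cast_pow, ← P.card_constant_on]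
    rfl
  calc clusterSum G z w (Fintype.card κ : R)
    _ = ∑ A : Finset ε, ∑ σ : ι → κ,
          (∏ e ∈ A, if σ (a e) = σ (b e) then w else 0) * z ^ Aᶜ.card := by
      simp_rw [P.clusterSum_eq_sum, ← hcount, hprod, Finset.mul_sum]
      exact Finset.sum_congr rfl fun A _ ↦ Finset.sum_congr rfl fun σ _ ↦ by ring
    _ = ∑ σ : ι → κ, ∏ e, ((if σ (a e) = σ (b e) then w else 0) + z) := by
      rw [Finset.sum_comm]
      simp_rw [Fintype.prod_add, Finset.prod_const]
    _ = _ := by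
      refine Finset.sum_congr rfl fun σ _ ↦ Finset.prod_congr rfl fun e _ ↦ ?_
      split_ifs <;> ring

theorem aeval_card_chromaticPolynomial [CommRing R] [Fintype ε] [Fintype ι] [Fintype κ]
    [DecidableEq ι] [DecidableEq κ] (P : Presentation G a b) :
    Polynomial.aeval (Fintype.card κ : R) G.chromaticPolynomial =
      ∑ σ : ι → κ, ∏ e, if σ (a e) = σ (b e) then 0 else 1 := by
  have : Finite E(G) := Finite.of_equiv _ P.edge
  simp [aeval_chromaticPolynomial E(G).toFinite, P.clusterSum_card_eq_sum_prod]

end Presentation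

theorem chromaticPolynomial_ne_zero {G : Graph α β} (hV : V(G).Finite) (hE : E(G).Finite)
    (hG : G.Loopless) : G.chromaticPolynomial ≠ 0 := by
  classical
  have := hV.fintype
  have := hE.fintype
  obtain ⟨a, b, ⟨P⟩⟩ := exists_presentation G
  have hne (e : E(G)) : a e ≠ b e := fun h ↦
    (P.isLink e).ne (congrArg (fun x ↦ (P.vert x : α)) h)
  have hpos : 0 < ∑ σ : V(G) → V(G), ∏ e, if σ (a e) = σ (b e) then (0 : ℤ) else 1 :=
    Finset.sum_pos' (fun σ _ ↦ Finset.prod_nonneg fun e _ ↦ by split_ifs <;> simp)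
      ⟨id, Finset.mem_univ _, by simp [hne]⟩
  intro h0
  rw [← P.aeval_card_chromaticPolynomial, h0, map_zero] at hpos
  exact hpos.false

end ClusterExpansion

section GraphConstructions

variable {α : Type u} {β : Type v}

theorem isDegenerate_of_rank {γ : Type*} [LinearOrder γ] [WellFoundedLT γ] {G : Graph α β}
    (hG : G.Loopless) (rank : α → γ) {k : ℕ}
    (h : ∀ x ∈ V(G), {e | ∃ y, G.IsLink e x y ∧ rank x ≤ rank y}.encard ≤ k) :
    G.IsDegenerate k := by
  refine iSup_le fun H ↦ iSup_le fun hH ↦ iSup_le fun hne ↦ ?_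
  obtain ⟨x, hx, hmin⟩ := (InvImage.wf rank wellFounded_lt).has_min V(H) hne
  refine (iInf₂_le x hx).trans (le_trans ?_ (h x (hH.vertexSet_mono hx)))
  have hloop : {e | H.IsLoopAt e x} = ∅ :=
    Set.eq_empty_of_forall_notMem fun e he ↦ (hG.anti hH).not_isLoopAt e x he
  rw [Graph.degree, hloop, Set.encard_empty, mul_zero, add_zero]
  refine Set.encard_le_encard ?_
  rintro e ⟨y, -, he⟩
  exact ⟨y, he.mono hH, not_lt.1 (hmin y he.right_mem)⟩

theorem reachable_of_isLink {G : Graph α β} {e : β} {x y : α} (h : G.IsLink e x y) :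
    G.toSimpleGraph.Reachable ⟨x, h.left_mem⟩ ⟨y, h.right_mem⟩ := by
  by_cases hxy : x = y
  · subst hxy
    rfl
  · exact SimpleGraph.Adj.reachable ⟨by simpa using hxy, e, h⟩

/-- The graph with vertices `V` and edges `E` in which `e` joins `fst e` to `snd e`. -/
def ofEnds (V : Set α) (E : Set β) (fst snd : β → α) (h : ∀ e ∈ E, fst e ∈ V ∧ snd e ∈ V) :
    Graph α β where
  vertexSet := V
  edgeSet := E
  IsLink e x y := e ∈ E ∧ (x = fst e ∧ y = snd e ∨ x = snd e ∧ y = fst e)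
  isLink_symm e _ := ⟨fun x y ⟨he, hxy⟩ ↦ ⟨he, by tauto⟩⟩
  eq_or_eq_of_isLink_of_isLink e x y v w h1 h2 := by grind
  edge_mem_iff_exists_isLink e := ⟨fun he ↦ ⟨_, _, he, .inl ⟨rfl, rfl⟩⟩, fun ⟨_, _, he, _⟩ ↦ he⟩
  left_mem_of_isLink e x y := by
    rintro ⟨he, ⟨rfl, -⟩ | ⟨rfl, -⟩⟩
    exacts [(h e he).1, (h e he).2]

section OfEnds

variable {V : Set α} {E : Set β} {fst snd : β → α} {h : ∀ e ∈ E, fst e ∈ V ∧ snd e ∈ V}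

theorem colorable_ofEnds {n : ℕ} (c : α → Fin n) (hc : ∀ e ∈ E, c (fst e) ≠ c (snd e)) :
    (ofEnds V E fst snd h).Colorable n := by
  refine ⟨fun x ↦ c x, ?_⟩
  rintro x y ⟨e, he, ⟨hx, hy⟩ | ⟨hx, hy⟩⟩
  · simpa only [hx, hy] using hc e he
  · simpa only [hx, hy] using (hc e he).symm

theorem loopless_ofEnds (hne : ∀ e ∈ E, fst e ≠ snd e) : (ofEnds V E fst snd h).Loopless := by
  refine ⟨?_⟩
  rintro e x ⟨he, ⟨hx, hx'⟩ | ⟨hx, hx'⟩⟩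
  exacts [hne e he (hx.symm.trans hx'), hne e he (hx'.symm.trans hx)]

end OfEnds

end GraphConstructions

section Inflation

variable {ι : Type u} {ε : Type v}

/-- The vertices of the inflation of a graph with vertices `ι` and edges `ε`: the original vertices,
a new vertex `mid e` for every edge `e`, and the `i`-th vertex `onPath e j i` of the `j`-th path
replacing `e`. -/
inductive InflVertex (ι : Type u) (ε : Type v) : Type (max u v)
  | orig (x : ι)
  | mid (e : ε)
  | onPath (e : ε) (j i : ℕ)

/-- The edges of the inflation of a graph with vertices `ι` and edges `ε`: an edge `link e` from
`mid e` to an end of `e`, and the `i`-th edge `seg e j i` of the `j`-th path replacing `e`. -/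
inductive InflEdge (ι : Type u) (ε : Type v) : Type (max u v)
  | link (e : ε)
  | seg (e : ε) (j i : ℕ)

open InflVertex InflEdge

/-- The `i`-th vertex, `0 ≤ i ≤ s`, on the `j`-th path of length `s` from `a e` to `mid e`. -/
def pathNode (a : ε → ι) (s : ℕ) (e : ε) (j i : ℕ) : InflVertex ι ε :=
  if i = 0 then orig (a e) else if i = s then mid e else onPath e j i

/-- The first end of an edge of the inflation. -/
def inflFst (a : ε → ι) (s : ℕ) : InflEdge ι ε → InflVertex ι ε
  | link e => mid e
  | seg e j i => pathNode a s e j i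

/-- The second end of an edge of the inflation. -/
def inflSnd (a b : ε → ι) (s : ℕ) : InflEdge ι ε → InflVertex ι ε
  | link e => orig (b e)
  | seg e j i => pathNode a s e j (i + 1)

/-- The vertices of the inflation by `p` paths of length `s`. -/
def inflVertexSet (ι : Type u) (ε : Type v) (s p : ℕ) : Set (InflVertex ι ε)
  | orig _ => True
  | mid _ => True
  | onPath _ j i => j < p ∧ 0 < i ∧ i < s

/-- The edges of the inflation by `p` paths of length `s`. -/
def inflEdgeSet (ι : Type u) (ε : Type v) (s p : ℕ) : Set (InflEdge ι ε)
  | link _ => True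
  | seg _ j i => j < p ∧ i < s

variable {a b : ε → ι} {s p : ℕ}

theorem pathNode_mem {e : ε} {j i : ℕ} (hj : j < p) (hi : i ≤ s) :
    pathNode a s e j i ∈ inflVertexSet ι ε s p := by
  unfold pathNode
  split_ifs with h0 hs
  exacts [trivial, trivial, ⟨hj, by omega, by omega⟩]

variable (a b s p) in
/-- The inflation of the graph in which `e` joins `a e` to `b e`: every edge `e` is replaced by `p`
paths of length `s` from `a e` to a new vertex `mid e`, followed by an edge from `mid e` to
`b e`. -/
def inflate : Graph (InflVertex ι ε) (InflEdge ι ε) :=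
  ofEnds (inflVertexSet ι ε s p) (inflEdgeSet ι ε s p) (inflFst a s) (inflSnd a b s) <| by
    rintro (e | ⟨e, j, i⟩) he
    exacts [⟨trivial, trivial⟩, ⟨pathNode_mem he.1 he.2.le, pathNode_mem he.1 he.2⟩]

theorem inflate_colorable_three : (inflate a b s p).Colorable 3 := by
  refine colorable_ofEnds (fun
    | orig _ => 0
    | mid _ => 1
    | onPath _ _ i => if i + 1 = s then 2 else if Even i then 0 else 1) ?_
  rintro (e | ⟨e, j, i⟩) hf
  · simp [inflFst, inflSnd]
  · obtain ⟨-, hi⟩ : j < p ∧ i < s := hf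
    have hparity : Even (i + 1) ↔ ¬ Even i := Nat.even_add_one
    simp only [inflFst, inflSnd, pathNode]
    grind

theorem inflate_isBipartite {α : Type*} {β : Type*} {G : Graph α β} (P : Presentation G a b)
    (hs : Even s) (hG : G.IsBipartite) : (inflate a b s p).IsBipartite := by
  obtain ⟨c, hc⟩ := hG
  refine colorable_ofEnds (fun
    | orig x => c (P.vert x)
    | mid e => c (P.vert (a e))
    | onPath e _ i => if Even i then c (P.vert (a e)) else (c (P.vert (a e))).rev) ?_
  rintro (e | ⟨e, j, i⟩) hf
  · exact hc _ _ ⟨_, P.isLink e⟩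
  · obtain ⟨-, hi⟩ : j < p ∧ i < s := hf
    have hrev (z : Fin 2) : z.rev ≠ z := by decide +revert
    have hparity : Even (i + 1) ↔ ¬ Even i := Nat.even_add_one
    simp only [inflFst, inflSnd, pathNode]
    grind

theorem inflate_loopless : (inflate a b s p).Loopless := by
  refine loopless_ofEnds ?_
  rintro (e | ⟨e, j, i⟩) _
  · simp [inflFst, inflSnd]
  · simp only [inflFst, inflSnd, pathNode]
    grind

/-- The order in which the vertices of the inflation are deleted to see that it is 2-degenerate. -/
def eliminationRank : InflVertex ι ε → ℕ
  | onPath _ _ _ => 0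
  | mid _ => 1
  | orig _ => 2

theorem inflate_isDegenerate_two (hs : 2 ≤ s) : (inflate a b s p).IsDegenerate 2 := by
  have encard_le {S : Set (InflEdge ι ε)} (f g) (h : S ⊆ {f, g}) : S.encard ≤ 2 :=
    (Set.encard_le_encard h).trans <|
      (Set.encard_insert_le _ _).trans (by rw [Set.encard_singleton]; rfl)
  refine isDegenerate_of_rank inflate_loopless eliminationRank ?_
  rintro (x | e | ⟨e, j, i⟩) _
  · refine (Set.encard_eq_zero.2 (Set.eq_empty_of_forall_notMem ?_)).trans_le zero_le
    rintro (e | ⟨e, j, i⟩) ⟨y, ⟨hf, hy⟩, hrank⟩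
    · grind [inflFst, inflSnd, eliminationRank]
    · obtain ⟨-, _⟩ : j < p ∧ i < s := hf
      grind [inflFst, inflSnd, pathNode, eliminationRank]
  · refine encard_le (link e) (link e) ?_
    rintro (e' | ⟨e', j, i⟩) ⟨y, ⟨hf, hy⟩, hrank⟩
    · grind [inflFst, inflSnd]
    · obtain ⟨-, _⟩ : j < p ∧ i < s := hf
      grind [inflFst, inflSnd, pathNode, eliminationRank]
  · refine encard_le (seg e j i) (seg e j (i - 1)) ?_
    rintro (e' | ⟨e', j', i'⟩) ⟨y, ⟨_, hy⟩, -⟩ <;>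
      grind [inflFst, inflSnd, pathNode]

theorem inflate_reachable_pathNode {e : ε} {j i : ℕ} (hj : j < p) (hi : i ≤ s) :
    (inflate a b s p).toSimpleGraph.Reachable ⟨orig (a e), trivial⟩
      ⟨pathNode a s e j i, pathNode_mem hj hi⟩ := by
  induction i with
  | zero => rfl
  | succ i ih =>
    have hseg : (inflate a b s p).IsLink (seg e j i) (pathNode a s e j i)
        (pathNode a s e j (i + 1)) := ⟨⟨hj, hi⟩, .inl ⟨rfl, rfl⟩⟩
    exact (ih (Nat.le_of_succ_le hi)).trans (reachable_of_isLink hseg)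

theorem inflate_reachable_mid (hs : s ≠ 0) (hp : p ≠ 0) (e : ε) :
    (inflate a b s p).toSimpleGraph.Reachable ⟨orig (a e), trivial⟩ ⟨mid e, trivial⟩ := by
  simpa [pathNode, hs] using
    inflate_reachable_pathNode (b := b) (e := e) (Nat.pos_of_ne_zero hp) (le_refl s)

theorem inflate_reachable_ends (hs : s ≠ 0) (hp : p ≠ 0) (e : ε) :
    (inflate a b s p).toSimpleGraph.Reachable ⟨orig (a e), trivial⟩ ⟨orig (b e), trivial⟩ := by
  have hlink : (inflate a b s p).IsLink (link e) (mid e) (orig (b e)) :=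
    ⟨trivial, .inl ⟨rfl, rfl⟩⟩
  exact (inflate_reachable_mid hs hp e).trans (reachable_of_isLink hlink)

theorem inflate_exists_reachable_orig (hs : s ≠ 0) (hp : p ≠ 0) (v : V(inflate a b s p)) :
    ∃ x, (inflate a b s p).toSimpleGraph.Reachable ⟨orig x, trivial⟩ v := by
  obtain ⟨x | e | ⟨e, j, i⟩, hv⟩ := v
  · exact ⟨x, .rfl⟩
  · exact ⟨a e, inflate_reachable_mid hs hp e⟩
  · obtain ⟨hj, hi, his⟩ : j < p ∧ 0 < i ∧ i < s := hv
    refine ⟨a e, ?_⟩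
    simpa [pathNode, hi.ne', his.ne] using inflate_reachable_pathNode (b := b) (e := e) hj his.le

theorem inflate_isConnected {α : Type*} {β : Type*} {G : Graph α β} (P : Presentation G a b)
    (hs : s ≠ 0) (hp : p ≠ 0) (hG : G.IsConnected) : (inflate a b s p).IsConnected := by
  have hstep {x y : V(G)} (hxy : G.toSimpleGraph.Adj x y) :
      (inflate a b s p).toSimpleGraph.Reachable ⟨orig (P.vert.symm x), trivial⟩
        ⟨orig (P.vert.symm y), trivial⟩ := by
    obtain ⟨-, f, hf⟩ := hxy
    obtain ⟨e, he⟩ := P.edge.surjective ⟨f, hf.edge_mem⟩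
    obtain rfl : (P.edge e : β) = f := congrArg Subtype.val he
    obtain ⟨x, rfl⟩ := P.vert.surjective x
    obtain ⟨y, rfl⟩ := P.vert.surjective y
    have hends := inflate_reachable_ends (a := a) (b := b) hs hp e
    obtain ⟨rfl, rfl⟩ | ⟨rfl, rfl⟩ := P.isLink_iff.1 hf
    · simpa using hends
    · simpa using hends.symm
  have horig (x y : V(G)) :
      (inflate a b s p).toSimpleGraph.Reachable ⟨orig (P.vert.symm x), trivial⟩
        ⟨orig (P.vert.symm y), trivial⟩ := by
    obtain ⟨w⟩ := hG.preconnected x y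
    induction w with
    | nil => rfl
    | cons h _ ih => exact (hstep h).trans ih
  obtain ⟨x₀⟩ := hG.nonempty
  refine (SimpleGraph.connected_iff_exists_forall_reachable _).2
    ⟨⟨orig (P.vert.symm x₀), trivial⟩, fun v ↦ ?_⟩
  obtain ⟨x, hx⟩ := inflate_exists_reachable_orig hs hp v
  obtain ⟨x, rfl⟩ := P.vert.symm.surjective x
  exact (horig x₀ x).trans hx

end Inflation

section WalkCounts

variable {κ R : Type*}

theorem sum_prod_curry [CommSemiring R] [Fintype κ] {X Y : Type*} [Fintype X] [DecidableEq X]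
    [Fintype Y] [DecidableEq Y] (g : X → (Y → κ) → R) :
    ∑ w : X × Y → κ, ∏ x, g x (fun y ↦ w (x, y)) = ∏ x, ∑ v, g x v := by
  rw [Finset.prod_univ_sum, Fintype.piFinset_univ, ← (Equiv.curry _ _ _).symm.sum_comp]
  rfl

variable [CommRing R]

/-- The number of walks of length `s` between two given distinct vertices of the complete graph
`K_q`, as a polynomial in `q`; it is `((q - 1)^s - (-1)^s) / q`. -/
def openWalkCount (s : ℕ) (q : R) : R :=
  ∑ i ∈ Finset.range s, (q - 1) ^ i * (-1) ^ (s - 1 - i)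

/-- The number of closed walks of length `s` at a given vertex of the complete graph `K_q`, as a
polynomial in `q`; it is the paper's `C_s(q)`. -/
def closedWalkCount (s : ℕ) (q : R) : R :=
  openWalkCount s q + (-1) ^ s

theorem mul_openWalkCount (s : ℕ) (q : R) :
    q * openWalkCount s q = (q - 1) ^ s - (-1) ^ s := by
  rw [← (Commute.all (q - 1) (-1)).geom_sum₂_mul, openWalkCount]
  ring

theorem mul_closedWalkCount (s : ℕ) (q : R) :
    q * closedWalkCount s q = (q - 1) ^ s + (q - 1) * (-1) ^ s := by
  rw [closedWalkCount, mul_add, mul_openWalkCount]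
  ring

theorem closedWalkCount_succ (s : ℕ) (q : R) :
    closedWalkCount (s + 1) q = (q - 1) * openWalkCount s q := by
  have hsucc : openWalkCount (s + 1) q = (q - 1) * openWalkCount s q + (-1) ^ s := by
    simp only [openWalkCount, add_tsub_cancel_right]
    rw [Finset.sum_range_succ', Finset.mul_sum]
    simp [pow_succ', mul_assoc, Nat.sub_sub, Nat.add_comm]
  rw [closedWalkCount, hsucc]
  ring

theorem openWalkCount_succ (s : ℕ) (q : R) :
    openWalkCount (s + 1) q = closedWalkCount s q + (q - 2) * openWalkCount s q := by
  have h := closedWalkCount_succ s q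
  rw [closedWalkCount] at h ⊢
  linear_combination h

theorem map_openWalkCount {S : Type*} [CommRing S] (f : R →+* S) (s : ℕ) (q : R) :
    f (openWalkCount s q) = openWalkCount s (f q) := by
  simp [openWalkCount]

theorem map_closedWalkCount {S : Type*} [CommRing S] (f : R →+* S) (s : ℕ) (q : R) :
    f (closedWalkCount s q) = closedWalkCount s (f q) := by
  simp [closedWalkCount, map_openWalkCount]

variable [Fintype κ] [DecidableEq κ]

theorem sum_ite_mul_ite (x y : κ) (C D : R) :
    ∑ c, (if x = c then 0 else 1) * (if c = y then C else D) =
      if x = y then (Fintype.card κ - 1) * D else C + (Fintype.card κ - 2) * D := by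
  have hsplit (c : κ) : (if x = c then 0 else 1) * (if c = y then C else D) =
      D + (if c = y then C - D else 0) - (if x = c then (if x = y then C else D) else 0) := by
    split_ifs <;> simp_all
  simp_rw [hsplit, Finset.sum_sub_distrib, Finset.sum_add_distrib]
  simp only [Finset.sum_const, Finset.card_univ, nsmul_eq_mul, Finset.sum_ite_eq',
    Finset.sum_ite_eq, Finset.mem_univ, if_true]
  split_ifs <;> ring

-- `w` lists the colours of the inner vertices, so that the `i`-th edge of the path has ends of
-- colours `Fin.cons x w i` and `Fin.snoc w y i`.
theorem sum_prod_path_colourings (s : ℕ) (x y : κ) :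
    ∑ w : Fin s → κ, ∏ i, (if Fin.cons (α := fun _ ↦ κ) x w i = Fin.snoc (α := fun _ ↦ κ) w y i
      then (0 : R) else 1) =
      if x = y then closedWalkCount (s + 1) (Fintype.card κ : R)
        else openWalkCount (s + 1) (Fintype.card κ : R) := by
  induction s generalizing x with
  | zero => simp [closedWalkCount, openWalkCount, Fin.snoc]
  | succ s ih =>
    rw [← (Fin.consEquiv fun _ : Fin (s + 1) ↦ κ).sum_comp, Fintype.sum_prod_type,
      closedWalkCount_succ (s + 1), openWalkCount_succ (s + 1), ← sum_ite_mul_ite]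
    refine Finset.sum_congr rfl fun c _ ↦ ?_
    rw [← ih c, Finset.mul_sum]
    refine Finset.sum_congr rfl fun w _ ↦ ?_
    simp [Fin.prod_univ_succ (n := s + 1), ← Fin.cons_snoc_eq_snoc_cons, Fin.consEquiv]

end WalkCounts

section ChromaticPolynomialInflate

open InflVertex InflEdge

variable {ι : Type u} {ε : Type v} (a b : ε → ι) (s p : ℕ)

/-- The vertices of the inflation, sorted by kind. -/
def inflVertexEquiv : ι ⊕ ε ⊕ (ε × Fin p) × Fin s ≃ V(inflate a b (s + 1) p) where
  toFun
    | .inl x => ⟨orig x, trivial⟩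
    | .inr (.inl e) => ⟨mid e, trivial⟩
    | .inr (.inr ((e, j), i)) => ⟨onPath e j (i + 1), j.2, Nat.succ_pos _, Nat.succ_lt_succ i.2⟩
  invFun
    | ⟨orig x, _⟩ => .inl x
    | ⟨mid e, _⟩ => .inr (.inl e)
    | ⟨onPath e j i, h⟩ => .inr (.inr ((e, ⟨j, h.1⟩),
        ⟨i - 1, (tsub_lt_iff_right h.2.1).2 h.2.2⟩))
  left_inv := by rintro (x | e | ⟨⟨e, j⟩, i⟩) <;> rfl
  right_inv := by
    rintro ⟨x | e | ⟨e, j, i⟩, h⟩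
    · rfl
    · rfl
    · obtain ⟨-, hi, -⟩ : j < p ∧ 0 < i ∧ i < s + 1 := h
      simp [Nat.sub_add_cancel hi]

/-- The edges of the inflation, sorted by kind. -/
def inflEdgeEquiv : ε ⊕ (ε × Fin p) × Fin s ≃ E(inflate a b s p) where
  toFun
    | .inl e => ⟨link e, trivial⟩
    | .inr ((e, j), i) => ⟨seg e j i, j.2, i.2⟩
  invFun
    | ⟨link e, _⟩ => .inl e
    | ⟨seg e j i, h⟩ => .inr ((e, ⟨j, h.1⟩), ⟨i, h.2⟩)
  left_inv := by rintro (e | ⟨⟨e, j⟩, i⟩) <;> rfl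
  right_inv := by rintro ⟨e | ⟨e, j, i⟩, h⟩ <;> rfl

theorem inflate_vertexSet_finite [Finite ι] [Finite ε] : V(inflate a b s p).Finite := by
  have : Finite V(inflate a b (s + 1) p) := .of_equiv _ (inflVertexEquiv a b s p)
  refine (Set.toFinite V(inflate a b (s + 1) p)).subset ?_
  rintro (x | e | ⟨e, j, i⟩) hx
  exacts [trivial, trivial, ⟨hx.1, hx.2.1, hx.2.2.trans s.lt_succ_self⟩]

theorem inflate_edgeSet_finite [Finite ε] : E(inflate a b s p).Finite :=
  have : Finite E(inflate a b s p) := .of_equiv _ (inflEdgeEquiv a b s p)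
  Set.toFinite _

/-- The first end of an edge of the inflation, in terms of the labels of `inflVertexEquiv` and
`inflEdgeEquiv`. -/
def inflLabelFst : ε ⊕ (ε × Fin p) × Fin (s + 1) → ι ⊕ ε ⊕ (ε × Fin p) × Fin s
  | .inl e => .inr (.inl e)
  | .inr (x, i) =>
    Fin.cons (α := fun _ ↦ ι ⊕ ε ⊕ (ε × Fin p) × Fin s)
      (.inl (a x.1)) (fun i ↦ .inr (.inr (x, i))) i

/-- The second end of an edge of the inflation, in terms of the labels of `inflVertexEquiv` and
`inflEdgeEquiv`. -/
def inflLabelSnd : ε ⊕ (ε × Fin p) × Fin (s + 1) → ι ⊕ ε ⊕ (ε × Fin p) × Fin s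
  | .inl e => .inl (b e)
  | .inr (x, i) =>
    Fin.snoc (α := fun _ ↦ ι ⊕ ε ⊕ (ε × Fin p) × Fin s)
      (fun i ↦ .inr (.inr (x, i))) (.inr (.inl x.1)) i

/-- The inflation as a graph on the labels of `inflVertexEquiv` and `inflEdgeEquiv`. -/
def inflatePresentation :
    Presentation (inflate a b (s + 1) p) (inflLabelFst a s p) (inflLabelSnd b s p) where
  vert := inflVertexEquiv a b s p
  edge := inflEdgeEquiv a b (s + 1) p
  isLink := by
    have hnode (e : ε) (j : Fin p) (i : Fin s) :
        onPath e j (i + 1) = pathNode a (s + 1) e j (i + 1) := by simp [pathNode, i.2.ne]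
    rintro (e | ⟨⟨e, j⟩, i⟩)
    · exact ⟨trivial, .inl ⟨rfl, rfl⟩⟩
    · refine ⟨⟨j.2, i.2⟩, .inl ⟨?_, ?_⟩⟩
      · refine Fin.cases rfl (fun i ↦ hnode e j i) i
      · refine Fin.lastCases ?_ (fun i ↦ ?_) i
        · simp [inflLabelSnd, inflVertexEquiv, inflEdgeEquiv, inflSnd, pathNode]
        · rw [inflLabelSnd, Fin.snoc_castSucc]
          exact hnode e j i

variable {a b s p}

section Colourings

variable {κ R : Type*} [CommRing R] [Fintype ι] [DecidableEq ι] [Fintype ε] [Fintype κ]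
  [DecidableEq κ]

theorem aeval_card_chromaticPolynomial_inflate_eq_sum [DecidableEq ε] :
    Polynomial.aeval (Fintype.card κ : R) (inflate a b (s + 1) p).chromaticPolynomial =
      ∑ σ : ι → κ, ∑ μ : ε → κ, ∑ w : (ε × Fin p) × Fin s → κ,
        (∏ e, if μ e = σ (b e) then 0 else 1) * ∏ x : ε × Fin p, ∏ i : Fin (s + 1),
          if Fin.cons (α := fun _ ↦ κ) (σ (a x.1)) (fun i ↦ w (x, i)) i =
            Fin.snoc (α := fun _ ↦ κ) (fun i ↦ w (x, i)) (μ x.1) i then 0 else 1 := by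
  have hcons (c : ι ⊕ ε ⊕ (ε × Fin p) × Fin s → κ) (x i) : c (inflLabelFst a s p (.inr (x, i))) =
      Fin.cons (α := fun _ ↦ κ) (c (.inl (a x.1))) (fun i ↦ c (.inr (.inr (x, i)))) i :=
    Fin.cases rfl (fun _ ↦ rfl) i
  have hsnoc (c : ι ⊕ ε ⊕ (ε × Fin p) × Fin s → κ) (x i) : c (inflLabelSnd b s p (.inr (x, i))) =
      Fin.snoc (α := fun _ ↦ κ) (fun i ↦ c (.inr (.inr (x, i)))) (c (.inr (.inl x.1))) i := by
    refine Fin.lastCases ?_ (fun i ↦ ?_) i <;> simp [inflLabelSnd]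
  simp only [(inflatePresentation a b s p).aeval_card_chromaticPolynomial, Fintype.prod_sum_type,
    Fintype.prod_prod_type, hcons, hsnoc]
  rw [← (Equiv.sumArrowEquivProdArrow _ _ _).symm.sum_comp, Fintype.sum_prod_type]
  refine Finset.sum_congr rfl fun σ _ ↦ ?_
  rw [← (Equiv.sumArrowEquivProdArrow _ _ _).symm.sum_comp, Fintype.sum_prod_type]
  rfl

theorem sum_prod_paths_colourings [DecidableEq ε] (f g : ε → κ) :
    ∑ w : (ε × Fin p) × Fin s → κ, ∏ x : ε × Fin p, ∏ i : Fin (s + 1),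
      (if Fin.cons (α := fun _ ↦ κ) (f x.1) (fun i ↦ w (x, i)) i =
        Fin.snoc (α := fun _ ↦ κ) (fun i ↦ w (x, i)) (g x.1) i then (0 : R) else 1) =
      ∏ e, if f e = g e then closedWalkCount (s + 1) (Fintype.card κ : R) ^ p
        else openWalkCount (s + 1) (Fintype.card κ : R) ^ p := by
  rw [sum_prod_curry fun (x : ε × Fin p) (v : Fin s → κ) ↦ ∏ i : Fin (s + 1),
    if Fin.cons (α := fun _ ↦ κ) (f x.1) v i = Fin.snoc (α := fun _ ↦ κ) v (g x.1) i
      then (0 : R) else 1]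
  rw [Fintype.prod_prod_type]
  refine Finset.prod_congr rfl fun e _ ↦ ?_
  exact (Finset.prod_congr rfl fun j _ ↦ sum_prod_path_colourings s (f e) (g e)).trans
    (by simp)

-- A parallel bundle of `p` paths in series with an edge acts as a single edge.
theorem aeval_card_chromaticPolynomial_inflate :
    Polynomial.aeval (Fintype.card κ : R) (inflate a b (s + 1) p).chromaticPolynomial =
      ∑ σ : ι → κ, ∏ e, if σ (a e) = σ (b e)
        then (Fintype.card κ - 1) * openWalkCount (s + 1) (Fintype.card κ : R) ^ p
        else closedWalkCount (s + 1) (Fintype.card κ : R) ^ p +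
          (Fintype.card κ - 2) * openWalkCount (s + 1) (Fintype.card κ : R) ^ p := by
  classical
  rw [aeval_card_chromaticPolynomial_inflate_eq_sum]
  refine Finset.sum_congr rfl fun σ _ ↦ ?_
  simp only [← Finset.mul_sum, sum_prod_paths_colourings fun e ↦ σ (a e),
    ← Finset.prod_mul_distrib]
  rw [← Fintype.piFinset_univ, ← Finset.prod_univ_sum (fun _ ↦ Finset.univ) fun e c ↦
    (if c = σ (b e) then (0 : R) else 1) *
      if σ (a e) = c then closedWalkCount (s + 1) (Fintype.card κ : R) ^ p
        else openWalkCount (s + 1) (Fintype.card κ : R) ^ p]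
  refine Finset.prod_congr rfl fun e _ ↦ ?_
  simp only [eq_comm (a := σ (a e)), ← sum_ite_mul_ite, eq_comm (b := σ (b e))]

end Colourings

theorem chromaticPolynomial_inflate {α : Type*} {β : Type*} {G : Graph α β}
    [Finite ι] [Finite ε] (P : Presentation G a b) :
    (inflate a b (s + 1) p).chromaticPolynomial = clusterSum G
      (closedWalkCount (s + 1) Polynomial.X ^ p +
        (Polynomial.X - 2) * openWalkCount (s + 1) Polynomial.X ^ p)
      (openWalkCount (s + 1) Polynomial.X ^ p - closedWalkCount (s + 1) Polynomial.X ^ p)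
      Polynomial.X := by
  classical
  have := Fintype.ofFinite ι
  have := Fintype.ofFinite ε
  refine Polynomial.eq_of_infinite_eval_eq _ _
    ((Set.infinite_range_of_injective (Nat.cast_injective (R := ℤ))).mono ?_)
  rintro _ ⟨n, rfl⟩
  have : Finite E(G) := Finite.of_equiv _ P.edge
  have hinfl := aeval_card_chromaticPolynomial_inflate (R := ℤ) (κ := Fin n) (a := a) (b := b)
    (s := s) (p := p)
  have hG := P.clusterSum_card_eq_sum_prod (R := ℤ) (κ := Fin n)
  simp only [Fintype.card_fin] at hinfl hG
  rw [Set.mem_ofPred_eq, ← Polynomial.coe_evalRingHom, map_clusterSum E(G).toFinite]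
  simp only [map_add, map_sub, map_mul, map_pow, map_closedWalkCount, map_openWalkCount,
    map_ofNat, Polynomial.coe_evalRingHom, Polynomial.eval_X, hG]
  rw [← Polynomial.coe_aeval_eq_eval, hinfl]
  refine Finset.sum_congr rfl fun σ _ ↦ Finset.prod_congr rfl fun e _ ↦ ?_
  congr 1
  ring

end ChromaticPolynomialInflate

section Limits

open Filter Topology Metric

theorem tendstoLocallyUniformlyOn_comp_pow {X Y R : Type*} [TopologicalSpace X] [UniformSpace Y]
    [NormedRing R] {Φ : X → R → Y} (hΦ : Continuous Φ.uncurry) {U : Set X} {r : X → R}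
    (hr : ContinuousOn r U) (hr1 : ∀ q ∈ U, ‖r q‖ < 1) :
    TendstoLocallyUniformlyOn (fun (p : ℕ) q ↦ Φ q (r q ^ p)) (fun q ↦ Φ q 0) atTop U := by
  rw [tendstoLocallyUniformlyOn_iff_forall_tendsto]
  intro x hx
  obtain ⟨ρ, hxρ, hρ⟩ := exists_between (hr1 x hx)
  have hle : ∀ᶠ y : ℕ × X in atTop ×ˢ 𝓝[U] x, ‖r y.2 ^ y.1‖ ≤ ρ ^ y.1 := by
    filter_upwards [(eventually_gt_atTop 0).prod_mk
      ((hr.norm x hx).eventually_lt_const hxρ)] with y hy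
    exact (norm_pow_le' _ hy.1).trans (pow_le_pow_left₀ (norm_nonneg _) hy.2.le _)
  have hpow : Tendsto (fun y : ℕ × X ↦ r y.2 ^ y.1) (atTop ×ˢ 𝓝[U] x) (𝓝 0) :=
    squeeze_zero_norm' hle ((tendsto_pow_atTop_nhds_zero_of_lt_one
      ((norm_nonneg _).trans hxρ.le) hρ).comp tendsto_fst)
  have hid : Tendsto (fun y : ℕ × X ↦ y.2) (atTop ×ˢ 𝓝[U] x) (𝓝 x) :=
    tendsto_snd.mono_right nhdsWithin_le_nhds
  have hlim := (hΦ.tendsto (x, 0)).comp (hid.prodMk_nhds tendsto_const_nhds)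
  have hpowlim := (hΦ.tendsto (x, 0)).comp (hid.prodMk_nhds hpow)
  exact (hlim.prodMk_nhds hpowlim).mono_right (nhds_le_uniformity _)

theorem exists_mem_ball_eq_zero_of_norm_lt {f : ℂ → ℂ} {c : ℂ} {r m : ℝ} (hr : 0 < r)
    (hf : DiffContOnCl ℂ f (ball c r)) (hm : ∀ z ∈ sphere c r, m ≤ ‖f z‖) (hc : ‖f c‖ < m) :
    ∃ z ∈ ball c r, f z = 0 := by
  by_contra! hne
  have hm0 : 0 < m := (norm_nonneg _).trans_lt hc
  have hne' : ∀ z ∈ closure (ball c r), f z ≠ 0 := by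
    rw [closure_ball c hr.ne', ← ball_union_sphere]
    rintro z (hz | hz)
    exacts [hne z hz, norm_pos_iff.1 (hm0.trans_le (hm z hz))]
  have hle : ‖(f c)⁻¹‖ ≤ m⁻¹ := by
    refine Complex.norm_le_of_forall_mem_frontier_norm_le isBounded_ball (hf.inv hne')
      (fun z hz ↦ ?_) (subset_closure (mem_ball_self hr))
    rw [frontier_ball c hr.ne'] at hz
    rw [Pi.inv_apply, norm_inv]
    exact inv_anti₀ hm0 (hm z hz)
  rw [norm_inv, inv_le_inv₀ (norm_pos_iff.2 (hne c (mem_ball_self hr))) hm0] at hle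
  exact hc.not_ge hle

variable {γ : Type*} {l : Filter γ}

theorem eventually_exists_zero_of_tendstoLocallyUniformlyOn {U : Set ℂ} (hU : IsOpen U)
    {f : γ → ℂ → ℂ} {g : ℂ → ℂ} (hf : ∀ p, DifferentiableOn ℂ (f p) U) (hg : ContinuousOn g U)
    (hfg : TendstoLocallyUniformlyOn f g l U) {q₀ : ℂ} (hq₀ : q₀ ∈ U) (h0 : g q₀ = 0)
    (hne : ∀ᶠ q in 𝓝[≠] q₀, g q ≠ 0) {ε : ℝ} (hε : 0 < ε) :
    ∀ᶠ p in l, ∃ q ∈ U, ‖q - q₀‖ < ε ∧ f p q = 0 := by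
  obtain ⟨δ, hδ, hsub⟩ := Metric.mem_nhds_iff.1
    ((eventually_nhdsWithin_iff.1 hne).and (hU.mem_nhds hq₀))
  obtain ⟨ρ, hρ, hρm⟩ := exists_between (lt_min hε hδ)
  obtain ⟨hρε, hρδ⟩ := lt_min_iff.1 hρm
  have hball : closedBall q₀ ρ ⊆ U := fun q hq ↦ (hsub (closedBall_subset_ball hρδ hq)).2
  have hsph : sphere q₀ ρ ⊆ U := sphere_subset_closedBall.trans hball
  obtain ⟨q₁, hq₁, hmin⟩ := (isCompact_sphere q₀ ρ).exists_isMinOn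
    (NormedSpace.sphere_nonempty.2 hρ.le) (hg.mono hsph).norm
  have hm : 0 < ‖g q₁‖ := norm_pos_iff.2 <|
    (hsub (closedBall_subset_ball hρδ (sphere_subset_closedBall hq₁))).1
      (ne_of_mem_sphere hq₁ hρ.ne')
  have hunif := (tendstoLocallyUniformlyOn_iff_forall_isCompact hU).1 hfg _ hball
    (isCompact_closedBall q₀ ρ)
  filter_upwards [Metric.tendstoUniformlyOn_iff.1 hunif _ (half_pos hm)] with p hp
  have hsphere (q) (hq : q ∈ sphere q₀ ρ) : ‖g q₁‖ / 2 ≤ ‖f p q‖ := by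
    have hle : ‖g q₁‖ ≤ ‖g q‖ := hmin hq
    have hclose := hp q (sphere_subset_closedBall hq)
    rw [dist_eq_norm] at hclose
    linarith [norm_sub_norm_le (g q) (f p q)]
  have hcenter : ‖f p q₀‖ < ‖g q₁‖ / 2 := by simpa [h0] using hp q₀ (mem_closedBall_self hρ.le)
  obtain ⟨q, hq, hfq⟩ := exists_mem_ball_eq_zero_of_norm_lt hρ
    (((hf p).mono hball).mono closure_ball_subset_closedBall).diffContOnCl hsphere hcenter
  exact ⟨q, hball (ball_subset_closedBall hq), (mem_ball_iff_norm.1 hq).trans hρε, hfq⟩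

theorem eventually_eval_mul_eval_neg_of_odd_rootMultiplicity {P : Polynomial ℝ} {x : ℝ}
    (h : Odd (P.rootMultiplicity x)) :
    ∀ᶠ d in 𝓝[>] (0 : ℝ), P.eval (x - d) * P.eval (x + d) < 0 := by
  have hP : P ≠ 0 := by
    rintro rfl
    simp at h
  obtain ⟨R, hR, hdvd⟩ := P.exists_eq_pow_rootMultiplicity_mul_and_not_dvd hP x
  rw [Polynomial.dvd_iff_isRoot] at hdvd
  have hcont : Continuous fun d ↦ R.eval (x - d) * R.eval (x + d) := by fun_prop
  have hpos : ∀ᶠ d in 𝓝[>] (0 : ℝ), 0 < R.eval (x - d) * R.eval (x + d) :=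
    (hcont.continuousAt.eventually_const_lt
      (by simpa using mul_self_pos.2 hdvd)).filter_mono nhdsWithin_le_nhds
  filter_upwards [hpos, self_mem_nhdsWithin] with d hd (hd0 : 0 < d)
  have hsplit : P.eval (x - d) * P.eval (x + d) =
      -((d ^ P.rootMultiplicity x) ^ 2 * (R.eval (x - d) * R.eval (x + d))) := by
    nth_rewrite 1 2 [hR]
    simp only [Polynomial.eval_mul, Polynomial.eval_pow, Polynomial.eval_sub, Polynomial.eval_X,
      Polynomial.eval_C, sub_sub_cancel_left, add_sub_cancel_left, h.neg_pow]
    ring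
  rw [hsplit, neg_lt_zero]
  positivity

theorem eventually_exists_zero_of_odd_rootMultiplicity {P : Polynomial ℝ} {x₀ : ℝ}
    (hodd : Odd (P.rootMultiplicity x₀)) {f : γ → ℝ → ℝ} {U : Set ℝ} (hU : U ∈ 𝓝 x₀)
    (hf : ∀ p, ContinuousOn (f p) U) (hlim : ∀ x ∈ U, Tendsto (f · x) l (𝓝 (P.eval x))) :
    ∀ᶠ p in l, ∃ x ∈ U, f p x = 0 := by
  obtain ⟨η, hη, hηU⟩ := Metric.mem_nhds_iff.1 hU
  obtain ⟨d, ⟨hneg, hdη⟩, hd : 0 < d⟩ :=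
    (((eventually_eval_mul_eval_neg_of_odd_rootMultiplicity hodd).and
      (nhdsWithin_le_nhds (Iio_mem_nhds hη))).and self_mem_nhdsWithin).exists
  have hsub : Set.Icc (x₀ - d) (x₀ + d) ⊆ U := by
    rw [← Real.closedBall_eq_Icc]
    exact (closedBall_subset_ball hdη).trans hηU
  have hle : x₀ - d ≤ x₀ + d := by linarith
  filter_upwards [((hlim _ (hsub (Set.left_mem_Icc.2 hle))).mul
    (hlim _ (hsub (Set.right_mem_Icc.2 hle)))).eventually_lt_const hneg] with p hp
  have hcont : ContinuousOn (f p) (Set.Icc (x₀ - d) (x₀ + d)) := (hf p).mono hsub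
  obtain ⟨h1, h2⟩ | ⟨h1, h2⟩ := mul_neg_iff.1 hp
  · obtain ⟨x, hx, hfx⟩ := intermediate_value_Icc' hle hcont ⟨h2.le, h1.le⟩
    exact ⟨x, hsub hx, hfx⟩
  · obtain ⟨x, hx, hfx⟩ := intermediate_value_Icc hle hcont ⟨h1.le, h2.le⟩
    exact ⟨x, hsub hx, hfx⟩

end Limits

section NormalisedPolynomials

open Filter Topology

variable {γ : Type*} {l : Filter γ} {C P : Polynomial ℤ} {Q : γ → Polynomial ℤ} {N : γ → ℕ}
  {U : Set ℂ}

theorem eventually_aeval_ne_zero (hP : P ≠ 0) (q₀ : ℂ) :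
    ∀ᶠ q in 𝓝[≠] q₀, Polynomial.aeval q P ≠ 0 := by
  filter_upwards [nhdsNE_of_nhdsNE_sdiff_finite univ_mem (P.rootSet_finite ℂ)] with q hq h0
  exact hq.2 (Polynomial.mem_rootSet.2 ⟨hP, h0⟩)

theorem eventually_exists_root_near (hU : IsOpen U) (hC : ∀ q ∈ U, Polynomial.aeval q C ≠ 0)
    (hP : P ≠ 0) (hlim : TendstoLocallyUniformlyOn
      (fun p q ↦ (Polynomial.aeval q C ^ N p)⁻¹ * Polynomial.aeval q (Q p))
      (fun q ↦ Polynomial.aeval q P) l U)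
    {q₀ : ℂ} (hq₀ : q₀ ∈ U) (h0 : Polynomial.aeval q₀ P = 0) {ε : ℝ} (hε : 0 < ε) :
    ∀ᶠ p in l, ∃ q : ℂ, ‖q - q₀‖ < ε ∧ Polynomial.aeval q (Q p) = 0 := by
  have hdiff (p) : DifferentiableOn ℂ
      (fun q : ℂ ↦ (Polynomial.aeval q C ^ N p)⁻¹ * Polynomial.aeval q (Q p)) U :=
    ((C.differentiable_aeval.differentiableOn.pow _).inv fun q hq ↦ pow_ne_zero _ (hC q hq)).mul
      (Q p).differentiable_aeval.differentiableOn
  filter_upwards [eventually_exists_zero_of_tendstoLocallyUniformlyOn hU hdiff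
    P.continuous_aeval.continuousOn hlim hq₀ h0 (eventually_aeval_ne_zero hP q₀) hε]
    with p ⟨q, hq, hlt, hz⟩
  exact ⟨q, hlt, (mul_eq_zero.1 hz).resolve_left (inv_ne_zero (pow_ne_zero _ (hC q hq)))⟩

theorem eventually_exists_real_root_near (hU : IsOpen U) (hC : ∀ q ∈ U, Polynomial.aeval q C ≠ 0)
    (hlim : TendstoLocallyUniformlyOn
      (fun p q ↦ (Polynomial.aeval q C ^ N p)⁻¹ * Polynomial.aeval q (Q p))
      (fun q ↦ Polynomial.aeval q P) l U)
    {q₀ : ℝ} (hq₀ : (q₀ : ℂ) ∈ U)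
    (hodd : Odd ((P.map (Int.castRingHom ℝ)).rootMultiplicity q₀)) {ε : ℝ} (hε : 0 < ε) :
    ∀ᶠ p in l, ∃ q ∈ Set.Ioo (q₀ - ε) (q₀ + ε), Polynomial.aeval q (Q p) = 0 := by
  have hcast (x : ℝ) (R : Polynomial ℤ) :
      Polynomial.aeval (x : ℂ) R = ((Polynomial.aeval x R : ℝ) : ℂ) :=
    Polynomial.aeval_algebraMap_apply ℂ x R
  have hCr {x : ℝ} (hx : (x : ℂ) ∈ U) : Polynomial.aeval x C ≠ 0 := fun h ↦
    hC x hx (by rw [hcast, h, Complex.ofReal_zero])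
  have hnhds : Set.Ioo (q₀ - ε) (q₀ + ε) ∩ (↑) ⁻¹' U ∈ 𝓝 q₀ :=
    inter_mem (Ioo_mem_nhds (by linarith) (by linarith))
      ((hU.preimage Complex.continuous_ofReal).mem_nhds hq₀)
  have hzero := eventually_exists_zero_of_odd_rootMultiplicity (l := l)
    (f := fun p x ↦ (Polynomial.aeval x C ^ N p)⁻¹ * Polynomial.aeval x (Q p)) hodd hnhds
    (fun p ↦ ((C.continuous_aeval.continuousOn.pow _).inv₀
      fun x hx ↦ pow_ne_zero _ (hCr hx.2)).mul (Q p).continuous_aeval.continuousOn)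
    fun x hx ↦ ?_
  · filter_upwards [hzero] with p ⟨x, hx, hfx⟩
    exact ⟨x, hx.1, (mul_eq_zero.1 hfx).resolve_left (inv_ne_zero (pow_ne_zero _ (hCr hx.2)))⟩
  · have hx := hlim.tendsto_at hx.2
    simp only [hcast] at hx
    rw [Polynomial.eval_map, ← algebraMap_int_eq, ← Polynomial.aeval_def]
    exact tendsto_ofReal_iff.1 (mod_cast hx)

end NormalisedPolynomials

section Convergence

open Filter Topology

theorem isOpen_regionQ (s : ℕ) : IsOpen (regionQ s) :=
  isOpen_lt (by fun_prop) (by fun_prop)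

theorem zero_notMem_regionQ {s : ℕ} : (0 : ℂ) ∉ regionQ s := by
  simp [regionQ]

theorem aeval_openWalkCount {R : Type*} [CommRing R] (s : ℕ) (q : R) :
    Polynomial.aeval q (openWalkCount s (Polynomial.X : Polynomial ℤ)) = openWalkCount s q := by
  simpa using map_openWalkCount (Polynomial.aeval (R := ℤ) q).toRingHom s Polynomial.X

theorem aeval_closedWalkCount {R : Type*} [CommRing R] (s : ℕ) (q : R) :
    Polynomial.aeval q (closedWalkCount s (Polynomial.X : Polynomial ℤ)) = closedWalkCount s q := by
  simpa using map_closedWalkCount (Polynomial.aeval (R := ℤ) q).toRingHom s Polynomial.X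

theorem cycleFactor_eq {s : ℕ} {q : ℂ} (hq : q ≠ 0) : cycleFactor s q = closedWalkCount s q := by
  rw [cycleFactor, ← mul_closedWalkCount, mul_div_cancel_left₀ _ hq]

theorem norm_openWalkCount_lt {s : ℕ} {q : ℂ} (hq : q ∈ regionQ s) :
    ‖openWalkCount s q‖ < ‖closedWalkCount s q‖ := by
  have h : ‖(q - 1) ^ s - (-1) ^ s‖ < ‖(q - 1) ^ s + (q - 1) * (-1) ^ s‖ := hq
  rw [← mul_closedWalkCount, ← mul_openWalkCount, norm_mul, norm_mul] at h
  exact lt_of_mul_lt_mul_left h (norm_nonneg q)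

theorem closedWalkCount_ne_zero {s : ℕ} {q : ℂ} (hq : q ∈ regionQ s) :
    closedWalkCount s q ≠ 0 :=
  norm_pos_iff.1 ((norm_nonneg _).trans_lt (norm_openWalkCount_lt hq))

theorem continuous_clusterSum {α : Type u} {β : Type v} {X R : Type*} [TopologicalSpace X]
    [CommSemiring R] [TopologicalSpace R] [IsTopologicalSemiring R] {G : Graph α β}
    (hE : E(G).Finite) {z w q : X → R} (hz : Continuous z) (hw : Continuous w)
    (hq : Continuous q) : Continuous fun x ↦ clusterSum G (z x) (w x) (q x) := by
  have hpow : E(G).powerset.Finite := hE.finite_subsets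
  simp only [clusterSum, finsum_mem_eq_finite_toFinset_sum _ hpow]
  fun_prop

variable {α : Type u} {β : Type v} {ι : Type u} {ε : Type v} {G : Graph α β} {a b : ε → ι}

theorem aeval_chromaticPolynomial_inflate {K : Type*} [Field K] [Finite ι] [Finite ε]
    (P : Presentation G a b) (s p : ℕ) {q : K} (hq : closedWalkCount (s + 1) q ≠ 0) :
    Polynomial.aeval q (inflate a b (s + 1) p).chromaticPolynomial =
      closedWalkCount (s + 1) q ^ (E(G).ncard * p) * clusterSum G
        (1 + (q - 2) * (openWalkCount (s + 1) q / closedWalkCount (s + 1) q) ^ p)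
        ((openWalkCount (s + 1) q / closedWalkCount (s + 1) q) ^ p - 1) q := by
  have : Finite E(G) := Finite.of_equiv _ P.edge
  have hq : closedWalkCount (s + 1) q ^ p ≠ 0 := pow_ne_zero p hq
  rw [chromaticPolynomial_inflate P, mul_comm E(G).ncard, pow_mul,
    ← clusterSum_mul_mul E(G).toFinite, div_pow]
  refine (map_clusterSum E(G).toFinite (Polynomial.aeval (R := ℤ) q).toRingHom _ _ _).trans ?_
  simp only [AlgHom.toRingHom_eq_coe, RingHom.coe_coe, map_add, map_sub, map_mul, map_pow,
    aeval_closedWalkCount, aeval_openWalkCount, Polynomial.aeval_X, map_ofNat]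
  congr 1 <;> field_simp

theorem tendstoLocallyUniformlyOn_inflate [Finite ι] [Finite ε] (P : Presentation G a b) {s : ℕ}
    (hs : s ≠ 0) :
    TendstoLocallyUniformlyOn
      (fun (p : ℕ) (q : ℂ) ↦
        (Polynomial.aeval q (closedWalkCount s (Polynomial.X : Polynomial ℤ)) ^
          (E(G).ncard * p))⁻¹ * Polynomial.aeval q (inflate a b s p).chromaticPolynomial)
      (fun q ↦ Polynomial.aeval q G.chromaticPolynomial) atTop (regionQ s) := by
  obtain ⟨s, rfl⟩ := Nat.exists_eq_succ_of_ne_zero hs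
  have : Finite E(G) := Finite.of_equiv _ P.edge
  have hΦ : Continuous (Function.uncurry fun q y : ℂ ↦
      clusterSum G (1 + (q - 2) * y) (y - 1) q) :=
    continuous_clusterSum E(G).toFinite (by fun_prop) (by fun_prop) (by fun_prop)
  have hratio : ContinuousOn
      (fun q : ℂ ↦ openWalkCount (s + 1) q / closedWalkCount (s + 1) q) (regionQ (s + 1)) := by
    refine ContinuousOn.div ?_ ?_ fun q hq ↦ closedWalkCount_ne_zero hq
    · exact (openWalkCount (s + 1) Polynomial.X).continuous_aeval.continuousOn.congr
        fun q _ ↦ (aeval_openWalkCount (s + 1) q).symm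
    · exact (closedWalkCount (s + 1) Polynomial.X).continuous_aeval.continuousOn.congr
        fun q _ ↦ (aeval_closedWalkCount (s + 1) q).symm
  have hlt (q) (hq : q ∈ regionQ (s + 1)) :
      ‖openWalkCount (s + 1) q / closedWalkCount (s + 1) q‖ < 1 := by
    rw [norm_div, div_lt_one (norm_pos_iff.2 (closedWalkCount_ne_zero hq))]
    exact norm_openWalkCount_lt hq
  refine ((tendstoLocallyUniformlyOn_comp_pow hΦ hratio hlt).congr fun p q hq ↦ ?_).congr_right
    fun q _ ↦ ?_
  · rw [aeval_closedWalkCount, aeval_chromaticPolynomial_inflate P s p (closedWalkCount_ne_zero hq),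
      inv_mul_cancel_left₀ (pow_ne_zero _ (closedWalkCount_ne_zero hq))]
  · simp [aeval_chromaticPolynomial E(G).toFinite]

end Convergence

section DiscDrawings

open Filter Topology Metric unitInterval

theorem exists_isOpenEmbedding_complex {S : Type*} [TopologicalSpace S]
    [ChartedSpace (EuclideanSpace ℝ (Fin 2)) S] {x : S} {U : Set S} (hU : U ∈ 𝓝 x) :
    ∃ ψ : ℂ → S, IsOpenEmbedding ψ ∧ ψ 0 = x ∧ Set.range ψ ⊆ U := by
  let φ := chartAt (EuclideanSpace ℝ (Fin 2)) x
  have hx : x ∈ φ.source := mem_chart_source _ x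
  have hmem : φ.target ∩ φ.symm ⁻¹' U ∈ 𝓝 (φ x) := by
    refine inter_mem (φ.open_target.mem_nhds (φ.map_source hx)) ?_
    refine (φ.continuousAt_symm (φ.map_source hx)).preimage_mem_nhds ?_
    rwa [φ.left_inv hx]
  obtain ⟨ρ, hρ, hball⟩ := Metric.mem_nhds_iff.1 hmem
  let B := OpenPartialHomeomorph.univBall (φ x) ρ
  have hB (z) : B z ∈ ball (φ x) ρ := by
    rw [← OpenPartialHomeomorph.univBall_target (φ x) hρ]
    exact B.map_source (by simp [B])
  let e := B.trans φ.symm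
  have he : e.source = Set.univ :=
    Set.eq_univ_of_forall fun z ↦ ⟨by simp [B], (hball (hB z)).1⟩
  refine ⟨e ∘ Complex.orthonormalBasisOneI.repr, (e.isOpenEmbedding he).comp
    Complex.orthonormalBasisOneI.repr.toHomeomorph.isOpenEmbedding, ?_, ?_⟩
  · simp [e, B, φ.left_inv hx]
  · rintro _ ⟨z, rfl⟩
    exact (hball (hB _)).2

variable {S : Type*} [TopologicalSpace S] [T2Space S]

theorem exists_last_exit {γ : I → S} (hγ : Continuous γ) {φ : ℂ → S} (hφ : IsOpenEmbedding φ)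
    (h0 : γ 0 = φ 0) {t₁ : I} (h1 : γ t₁ ∉ φ '' closedBall 0 1) :
    ∃ t₀ ∈ Set.Ioo 0 t₁, (∃ z, ‖z‖ = 1 ∧ γ t₀ = φ z) ∧
      ∀ t ∈ Set.Ioc t₀ t₁, γ t ∉ φ '' closedBall 0 1 := by
  have hclosed : IsClosed (γ ⁻¹' (φ '' closedBall 0 1) ∩ Set.Iic t₁) :=
    (((isCompact_closedBall 0 1).image hφ.continuous).isClosed.preimage hγ).inter isClosed_Iic
  obtain ⟨t₀, ⟨⟨z, hz, hzt⟩, ht₀₁⟩, hmax⟩ :=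
    hclosed.isCompact.exists_isGreatest ⟨0, ⟨0, by simp, h0.symm⟩, t₁.2.1⟩
  have hlt : t₀ < t₁ := lt_of_le_of_ne ht₀₁ fun h ↦ h1 (h ▸ ⟨z, hz, hzt⟩)
  have hz1 : ‖z‖ = 1 := by
    refine le_antisymm (by simpa using hz) (not_lt.1 fun hlt' ↦ ?_)
    have hinside : ∀ᶠ t in 𝓝[>] t₀, γ t ∈ φ '' ball 0 1 ∧ t < t₁ :=
      nhdsWithin_le_nhds <| inter_mem
        (((hφ.isOpenMap (ball 0 1) isOpen_ball).preimage hγ).mem_nhds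
          ⟨z, by simpa using hlt', hzt⟩) (Iio_mem_nhds hlt)
    have : (𝓝[>] t₀).NeBot := nhdsGT_neBot_of_exists_gt ⟨t₁, hlt⟩
    obtain ⟨t, ⟨ht, ht₁⟩, ht₀⟩ := (hinside.and self_mem_nhdsWithin).exists
    exact (hmax ⟨Set.image_mono ball_subset_closedBall ht, ht₁.le⟩).not_gt ht₀
  refine ⟨t₀, ⟨lt_of_le_of_ne t₀.2.1 ?_, hlt⟩, ⟨z, hz1, hzt.symm⟩,
    fun t ht hmem ↦ (hmax ⟨hmem, ht.2⟩).not_gt ht.1⟩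
  rintro rfl
  simp [hφ.injective (hzt.trans h0)] at hz1

theorem exists_strictMono_unitInterval {u v : I} (h : u < v) :
    ∃ r : I → I, Continuous r ∧ StrictMono r ∧ r 0 = u ∧ r 1 = v := by
  have huv : (u : ℝ) < v := h
  let r (t : I) : Set.Icc (u : ℝ) v := (iccHomeoI (u : ℝ) v huv).symm t
  have hr (t : I) : (r t : ℝ) = (v - u) * t + u := iccHomeoI_symm_apply_coe ..
  refine ⟨fun t ↦ ⟨r t, Set.Icc_subset_Icc u.2.1 v.2.2 (r t).2⟩, by fun_prop, fun t t' ht ↦ ?_,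
    Subtype.ext (by simp [hr]), Subtype.ext (by simp [hr])⟩
  have hlt : (t : ℝ) < t' := ht
  refine Subtype.mk_lt_mk.2 ?_
  rw [hr, hr]
  gcongr

theorem exists_subarc {γ : I → S} (hγ : Continuous γ) {φ ψ : ℂ → S} (hφ : IsOpenEmbedding φ)
    (hψ : IsOpenEmbedding ψ) (hdisj : Disjoint (Set.range φ) (Set.range ψ)) (h0 : γ 0 = φ 0)
    (h1 : γ 1 = ψ 0) :
    ∃ r : I → I, Continuous r ∧ Function.Injective r ∧ Set.range r ⊆ Set.Ioo 0 1 ∧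
      (∃ z, ‖z‖ = 1 ∧ γ (r 0) = φ z) ∧ (∃ z, ‖z‖ = 1 ∧ γ (r 1) = ψ z) ∧
      ∀ t ∈ Set.Ioo 0 1, γ (r t) ∉ φ '' closedBall 0 1 ∧ γ (r t) ∉ ψ '' closedBall 0 1 := by
  have hne (z w) : φ z ≠ ψ w := Set.disjoint_range_iff.1 hdisj z w
  obtain ⟨t₀, ⟨h0t₀, -⟩, ⟨z, hz, hzt⟩, hexit⟩ := exists_last_exit hγ hφ h0 (t₁ := 1) <| by
    rintro ⟨z, -, hz⟩
    exact hne z 0 (hz.trans h1)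
  obtain ⟨u, ⟨h0u, hut₀⟩, ⟨w, hw, hwu⟩, hentry⟩ := exists_last_exit
    (hγ.comp unitInterval.continuous_symm) hψ (by simpa using h1) (t₁ := σ t₀) <| by
      rintro ⟨w, -, hw⟩
      exact hne z w (by simpa [hzt] using hw.symm)
  have hlt : t₀ < σ u := unitInterval.lt_symm_comm.1 hut₀
  have hu1 : σ u < 1 := by simpa using unitInterval.symm_lt_symm.2 h0u
  obtain ⟨r, hr, hmono, hr0, hr1⟩ := exists_strictMono_unitInterval hlt
  have hmem (t) : r t ∈ Set.Icc t₀ (σ u) :=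
    ⟨hr0 ▸ hmono.monotone t.2.1, hr1 ▸ hmono.monotone t.2.2⟩
  refine ⟨r, hr, hmono.injective, ?_, ⟨z, hz, hr0 ▸ hzt⟩, ⟨w, hw, hr1 ▸ hwu⟩, fun t ht ↦ ⟨?_, ?_⟩⟩
  · rintro _ ⟨t, rfl⟩
    exact ⟨h0t₀.trans_le (hmem t).1, (hmem t).2.trans_lt hu1⟩
  · exact hexit _ ⟨hr0 ▸ hmono ht.1, (r t).2.2⟩
  · simpa using hentry (σ (r t))
      ⟨unitInterval.lt_symm_comm.1 (hr1 ▸ hmono ht.2), unitInterval.symm_le_symm.2 (hmem t).1⟩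

/-- A drawing without crossings on `S` of the graph with vertices `ι` and with edges `ε`, the ends
of `e` being `a e` and `b e`. -/
structure ArcDrawing {ι ε : Type*} (a b : ε → ι) (S : Type*) [TopologicalSpace S] where
  /-- The point drawn for a vertex. -/
  pt : ι → S
  /-- The arc drawn for an edge. -/
  arc (e : ε) : Path (pt (a e)) (pt (b e))
  pt_injective : Function.Injective pt
  arc_ne_pt (e : ε) {t : I} (ht : t ∈ Set.Ioo 0 1) (x : ι) : arc e t ≠ pt x
  arc_injOn {e f : ε} {t t' : I} (ht : t ∈ Set.Ioo 0 1) (ht' : t' ∈ Set.Ioo 0 1)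
    (h : arc e t = arc f t') : e = f ∧ t = t'

/-- A drawing in which the vertices are the centres of disjoint discs and each edge consists of a
radius of the unit disc at either end and of an arc outside of the unit discs. -/
structure DiscDrawing {ι ε : Type*} (a b : ε → ι) (S : Type*) [TopologicalSpace S] where
  /-- The coordinates around a vertex. -/
  disc (x : ι) : ℂ → S
  /-- The direction in which a dart leaves its vertex. -/
  dir : ε × Bool → ℂ
  /-- The part of an edge outside of the unit discs. -/
  outer (e : ε) : Path (disc (a e) (dir (e, false))) (disc (b e) (dir (e, true)))
  continuous_disc (x : ι) : Continuous (disc x)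
  disc_inj {x y : ι} {z w : ℂ} (h : disc x z = disc y w) : x = y ∧ z = w
  norm_dir (d : ε × Bool) : ‖dir d‖ = 1
  outer_inj {e f : ε} {t t' : I} (h : outer e t = outer f t') : e = f ∧ t = t'
  outer_ne_disc (e : ε) {t : I} (ht : t ∈ Set.Ioo 0 1) (x : ι) {z : ℂ} (hz : ‖z‖ ≤ 1) :
    outer e t ≠ disc x z

variable {ι ε : Type*} {a b : ε → ι}

theorem Presentation.nonempty_arcDrawing {α β S : Type*} [TopologicalSpace S] {G : Graph α β}
    (P : Presentation G a b) (h : G.EmbeddableOn S) : Nonempty (ArcDrawing a b S) := by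
  obtain ⟨pt, arc, hpt, hends, harc, hinj⟩ := h
  have horient (e : ε) : ∃ (γ : Path (pt (P.vert (a e))) (pt (P.vert (b e)))) (r : I → I),
      Function.Injective r ∧ (∀ t ∈ Set.Ioo 0 1, r t ∈ Set.Ioo 0 1) ∧
      ∀ t, γ t = arc (P.edge e) (r t) := by
    rcases Sym2.eq_iff.1 (hends _ _ _ (P.isLink e)) with ⟨h0, h1⟩ | ⟨h0, h1⟩
    · exact ⟨⟨arc (P.edge e), h0, h1⟩, id, Function.injective_id, fun t ht ↦ ht, fun t ↦ rfl⟩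
    · refine ⟨Path.symm ⟨arc (P.edge e), h0, h1⟩, σ, unitInterval.symm_bijective.injective,
        fun t ht ↦ ⟨?_, ?_⟩, fun t ↦ rfl⟩
      · exact unitInterval.lt_symm_comm.1 (by simpa using ht.2)
      · exact unitInterval.symm_lt_comm.1 (by simpa using ht.1)
  choose γ r hr hrIoo hγ using horient
  refine ⟨{
    pt := fun x ↦ pt (P.vert x)
    arc := γ
    pt_injective := hpt.comp P.vert.injective
    arc_ne_pt := fun e t ht x ↦ hγ e t ▸ harc _ _ (hrIoo e t ht) _
    arc_injOn := fun {e f t t'} ht ht' h ↦ ?_ }⟩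
  rw [hγ, hγ] at h
  obtain ⟨hef, htt'⟩ := hinj _ _ _ (hrIoo e t ht) _ (hrIoo f t' ht') h
  obtain rfl := P.edge.injective hef
  exact ⟨rfl, hr e htt'⟩

namespace ArcDrawing

theorem pt_notMem_range_arc {S : Type*} [TopologicalSpace S] (D : ArcDrawing a b S) {x : ι}
    {e : ε} (ha : x ≠ a e) (hb : x ≠ b e) : D.pt x ∉ Set.range (D.arc e) := by
  rintro ⟨t, ht⟩
  obtain rfl | h0 := eq_or_lt_of_le (unitInterval.nonneg' (t := t))
  · exact ha (D.pt_injective (ht.symm.trans (D.arc e).source))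
  obtain rfl | h1 := eq_or_lt_of_le (unitInterval.le_one' (t := t))
  · exact hb (D.pt_injective (ht.symm.trans (D.arc e).target))
  exact D.arc_ne_pt e ⟨h0, h1⟩ x ht

variable {S : Type*} [TopologicalSpace S] [T2Space S] [ChartedSpace (EuclideanSpace ℝ (Fin 2)) S]
  [Finite ι] [Finite ε]

theorem exists_discs (D : ArcDrawing a b S) :
    ∃ ψ : ι → ℂ → S, (∀ x, IsOpenEmbedding (ψ x)) ∧ (∀ x, ψ x 0 = D.pt x) ∧
      (∀ x y, x ≠ y → Disjoint (Set.range (ψ x)) (Set.range (ψ y))) ∧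
      ∀ x e t z, D.arc e t = ψ x z → x = a e ∨ x = b e := by
  obtain ⟨U, hU, hdisj⟩ := (Set.finite_range D.pt).t2_separation
  have hN (x : ι) :
      U (D.pt x) ∩ ⋂ e ∈ {e | x ≠ a e ∧ x ≠ b e}, (Set.range (D.arc e))ᶜ ∈ 𝓝 (D.pt x) := by
    refine inter_mem ((hU _).2.mem_nhds (hU _).1) ((biInter_mem (Set.toFinite _)).2 fun e hx ↦ ?_)
    exact (isCompact_range (D.arc e).continuous).isClosed.isOpen_compl.mem_nhds
      (D.pt_notMem_range_arc hx.1 hx.2)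
  choose ψ hψ hψ0 hψN using fun x ↦ exists_isOpenEmbedding_complex (hN x)
  refine ⟨ψ, hψ, hψ0, fun x y hxy ↦ ?_, fun x e t z h ↦ ?_⟩
  · exact (hdisj ⟨x, rfl⟩ ⟨y, rfl⟩ (D.pt_injective.ne hxy)).mono
      ((hψN x).trans Set.inter_subset_left) ((hψN y).trans Set.inter_subset_left)
  · by_contra! hx
    exact Set.mem_iInter₂.1 (hψN x ⟨z, rfl⟩).2 e hx ⟨t, h⟩

theorem nonempty_discDrawing (D : ArcDrawing a b S) (hab : ∀ e, a e ≠ b e) :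
    Nonempty (DiscDrawing a b S) := by
  obtain ⟨ψ, hψ, hψ0, hdisj, hincident⟩ := D.exists_discs
  choose r hr hrinj hrIoo hz hw havoid using fun e ↦ exists_subarc (D.arc e).continuous
    (hψ (a e)) (hψ (b e)) (hdisj _ _ (hab e)) (by rw [(D.arc e).source, hψ0])
    (by rw [(D.arc e).target, hψ0])
  choose z hz hrz using hz
  choose w hw hrw using hw
  exact ⟨{
    disc := ψ
    dir := fun d ↦ bif d.2 then w d.1 else z d.1
    outer := fun e ↦ ⟨⟨_, (D.arc e).continuous.comp (hr e)⟩, hrz e, hrw e⟩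
    continuous_disc := fun x ↦ (hψ x).continuous
    disc_inj := by
      intro x y z w h
      obtain rfl : x = y := by
        by_contra hxy
        exact Set.disjoint_range_iff.1 (hdisj x y hxy) z w h
      exact ⟨rfl, (hψ x).injective h⟩
    norm_dir := by
      rintro ⟨e, _ | _⟩
      exacts [hz e, hw e]
    outer_inj := by
      intro e f t t' h
      obtain ⟨rfl, htt'⟩ := D.arc_injOn (hrIoo e ⟨t, rfl⟩) (hrIoo f ⟨t', rfl⟩) h
      exact ⟨rfl, hrinj e htt'⟩
    outer_ne_disc := by
      intro e t ht x ζ hζ h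
      have hmem : D.arc e (r e t) ∈ ψ x '' closedBall 0 1 := ⟨ζ, by simpa using hζ, h.symm⟩
      rcases hincident _ _ _ _ h with rfl | rfl
      exacts [(havoid e t ht).1 hmem, (havoid e t ht).2 hmem] }⟩

end ArcDrawing

end DiscDrawings

section DiscCoordinates

open Filter Topology Metric unitInterval

variable {ι ε : Type*} {a b : ε → ι}

/-- The vertex at which a dart starts: the dart `(e, false)` is the edge `e` seen from its first
end, the dart `(e, true)` is the edge seen from its second end. -/
def dartEnd (a b : ε → ι) : ε × Bool → ι
  | (e, false) => a e
  | (e, true) => b e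

/-- A point of a disc drawing: the centre of a disc, the point at distance `r` from the centre on
the ray that makes the angle `τ` with a dart, or a point of an arc outside of the discs. -/
inductive DiscCoord (ι ε : Type*)
  | center (x : ι)
  | sector (d : ε × Bool) (r τ : ℝ)
  | outer (e : ε) (t : ℝ)

/-- The coordinates of the points in the sectors of angle `δ` next to the darts, and of those
outside of the discs, each point having one coordinate. -/
def discCoordSet (ι ε : Type*) (δ : ℝ) : Set (DiscCoord ι ε)
  | .center _ => True
  | .sector _ r τ => r ∈ Set.Ioc 0 1 ∧ τ ∈ Set.Icc 0 δ
  | .outer _ t => t ∈ Set.Ioo 0 1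

namespace DiscDrawing

variable {S : Type*} [TopologicalSpace S] (D : DiscDrawing a b S)

/-- The sectors of angle `δ` next to the darts are disjoint: `δ` is a common angular width that
suits all darts. -/
def IsSectorAngle (δ : ℝ) : Prop :=
  0 < δ ∧ ∀ d d', dartEnd a b d = dartEnd a b d' → ∀ τ ∈ Set.Icc 0 δ, ∀ τ' ∈ Set.Icc 0 δ,
    D.dir d * Complex.exp (τ * Complex.I) = D.dir d' * Complex.exp (τ' * Complex.I) →
      d = d' ∧ τ = τ'

/-- The point of `S` with given disc coordinates. -/
noncomputable def point : DiscCoord ι ε → S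
  | .center x => D.disc x 0
  | .sector d r τ => D.disc (dartEnd a b d) (r * (D.dir d * Complex.exp (τ * Complex.I)))
  | .outer e t => (D.outer e).extend t

theorem dir_ne_zero (d : ε × Bool) : D.dir d ≠ 0 :=
  norm_ne_zero_iff.1 (by simp [D.norm_dir d])

theorem dart_eq_of_dir_eq {d d' : ε × Bool} (hend : dartEnd a b d = dartEnd a b d')
    (hdir : D.dir d = D.dir d') : d = d' := by
  have houter (d : ε × Bool) :
      D.disc (dartEnd a b d) (D.dir d) = D.outer d.1 (bif d.2 then 1 else 0) := by
    obtain ⟨e, _ | _⟩ := d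
    exacts [(D.outer e).source.symm, (D.outer e).target.symm]
  have h := houter d'
  rw [← hend, ← hdir, houter d] at h
  obtain ⟨he, hside⟩ := D.outer_inj h
  obtain ⟨e, _ | _⟩ := d <;> obtain ⟨e', _ | _⟩ := d' <;> simp_all

theorem exists_isSectorAngle [Finite ε] : ∃ δ, D.IsSectorAngle δ := by
  have hsep (d d' : ε × Bool) : ∀ᶠ v : ℝ × ℝ in 𝓝 0, dartEnd a b d = dartEnd a b d' →
      D.dir d * Complex.exp (v.1 * Complex.I) = D.dir d' * Complex.exp (v.2 * Complex.I) →
        d = d' := by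
    by_cases h : dartEnd a b d = dartEnd a b d' ∧ D.dir d ≠ D.dir d'
    · have hcont : Continuous fun v : ℝ × ℝ ↦ D.dir d * Complex.exp (v.1 * Complex.I) -
          D.dir d' * Complex.exp (v.2 * Complex.I) := by fun_prop
      filter_upwards [hcont.continuousAt.eventually_ne (y := 0) (by simpa [sub_eq_zero] using h.2)]
        with v hv _ heq
      exact absurd (sub_eq_zero.2 heq) hv
    · refine .of_forall fun v hend _ ↦ D.dart_eq_of_dir_eq hend ?_
      by_contra hdir
      exact h ⟨hend, hdir⟩
  obtain ⟨η, hη, hball⟩ := Metric.eventually_nhds_iff.1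
    (eventually_all.2 fun d ↦ eventually_all.2 (hsep d))
  obtain ⟨δ, hδ, hlt⟩ := exists_between (lt_min hη Real.pi_pos)
  obtain ⟨hδη, hδπ⟩ := lt_min_iff.1 hlt
  refine ⟨δ, hδ, fun d d' hend τ hτ τ' hτ' h ↦ ?_⟩
  have habs {τ : ℝ} (hτ : τ ∈ Set.Icc 0 δ) : |τ| < η :=
    (abs_of_nonneg hτ.1).trans_lt (hτ.2.trans_lt hδη)
  obtain rfl : d = d' := hball (y := (τ, τ'))
    (by simpa [Prod.dist_eq] using ⟨habs hτ, habs hτ'⟩) d d' hend h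
  have hexp := Complex.exp_inj_of_neg_pi_lt_of_le_pi (by simp; linarith [hτ.1, Real.pi_pos])
    (by simp; linarith [hτ.2]) (by simp; linarith [hτ'.1, Real.pi_pos])
    (by simp; linarith [hτ'.2]) (mul_left_cancel₀ (D.dir_ne_zero d) h)
  exact ⟨rfl, by simpa using hexp⟩

theorem norm_sector (d : ε × Bool) {r : ℝ} (hr : 0 ≤ r) (τ : ℝ) :
    ‖(r * (D.dir d * Complex.exp (τ * Complex.I)) : ℂ)‖ = r := by
  rw [norm_mul, norm_mul, D.norm_dir, Complex.norm_exp_ofReal_mul_I, Complex.norm_real,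
    Real.norm_of_nonneg hr, mul_one, mul_one]

theorem point_outer {e : ε} {t : ℝ} (ht : t ∈ Set.Ioo 0 1) :
    D.point (.outer e t) = D.outer e ⟨t, Set.Ioo_subset_Icc_self ht⟩ :=
  Path.extend_apply ..

theorem point_outer_ne_disc {e : ε} {t : ℝ} (ht : t ∈ Set.Ioo 0 1) (x : ι) {z : ℂ}
    (hz : ‖z‖ ≤ 1) : D.point (.outer e t) ≠ D.disc x z := by
  rw [D.point_outer ht]
  exact D.outer_ne_disc e (t := ⟨t, _⟩) ⟨ht.1, ht.2⟩ x hz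

theorem center_ne_sector (x : ι) (d : ε × Bool) {r : ℝ} (hr : 0 < r) (τ : ℝ) :
    D.point (.center x) ≠ D.point (.sector d r τ) := fun h ↦ by
  have hnorm := D.norm_sector d hr.le τ
  rw [← (D.disc_inj h).2, norm_zero] at hnorm
  exact hr.ne hnorm

variable {D}

theorem IsSectorAngle.sector_inj {δ : ℝ} (hδ : D.IsSectorAngle δ) {d d' : ε × Bool}
    {r r' τ τ' : ℝ} (hr : 0 < r) (hr' : 0 < r') (hτ : τ ∈ Set.Icc 0 δ) (hτ' : τ' ∈ Set.Icc 0 δ)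
    (h : D.point (.sector d r τ) = D.point (.sector d' r' τ')) : d = d' ∧ r = r' ∧ τ = τ' := by
  obtain ⟨hend, hz⟩ := D.disc_inj h
  obtain rfl : r = r' := by
    simpa only [D.norm_sector _ hr.le, D.norm_sector _ hr'.le] using congrArg norm hz
  obtain ⟨hd, hττ'⟩ := hδ.2 d d' hend τ hτ τ' hτ'
    (mul_left_cancel₀ (Complex.ofReal_ne_zero.2 hr.ne') hz)
  exact ⟨hd, rfl, hττ'⟩

theorem IsSectorAngle.injOn_point {δ : ℝ} (hδ : D.IsSectorAngle δ) :
    Set.InjOn D.point (discCoordSet ι ε δ) := by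
  have hle {d : ε × Bool} {r τ : ℝ} (hr : r ∈ Set.Ioc 0 1) :
      ‖(r * (D.dir d * Complex.exp (τ * Complex.I)) : ℂ)‖ ≤ 1 :=
    (D.norm_sector d hr.1.le τ).trans_le hr.2
  rintro (x | ⟨d, r, τ⟩ | ⟨e, t⟩) hc (x' | ⟨d', r', τ'⟩ | ⟨e', t'⟩) hc' h
  · rw [(D.disc_inj h).1]
  · exact absurd h (D.center_ne_sector x d' hc'.1.1 τ')
  · exact absurd h.symm (D.point_outer_ne_disc hc' x (by simp))
  · exact absurd h.symm (D.center_ne_sector x' d hc.1.1 τ)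
  · obtain ⟨rfl, rfl, rfl⟩ := hδ.sector_inj hc.1.1 hc'.1.1 hc.2 hc'.2 h
    rfl
  · exact absurd h.symm (D.point_outer_ne_disc hc' _ (hle hc.1))
  · exact absurd h (D.point_outer_ne_disc hc x' (by simp))
  · exact absurd h (D.point_outer_ne_disc hc _ (hle hc'.1))
  · rw [D.point_outer hc, D.point_outer hc'] at h
    obtain ⟨rfl, htt'⟩ := D.outer_inj h
    rw [Subtype.mk.inj htt']

end DiscDrawing

end DiscCoordinates

section InflationDrawing

open Topology unitInterval

/-- A point of the topological space that the inflation subdivides: every edge is replaced by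
paths, numbered by `j`, from its first end to a middle point and by a link from there to its second
end. The middle point is the point `t = 0` of the link. -/
inductive InflPoint (ι ε : Type*)
  | orig (x : ι)
  | link (e : ε) (t : ℝ)
  | path (e : ε) (j : ℕ) (t : ℝ)

/-- The parameters for which no point of the space is represented twice. -/
def inflPointSet (ι ε : Type*) : Set (InflPoint ι ε)
  | .orig _ => True
  | .link _ t => t ∈ Set.Ico 0 1
  | .path _ _ t => t ∈ Set.Ioo 0 1

variable {ι : Type u} {ε : Type v}

/-- The position of a vertex of the inflation. -/
noncomputable def InflVertex.toPoint (s : ℕ) : InflVertex ι ε → InflPoint ι ε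
  | orig x => .orig x
  | mid e => .link e 0
  | onPath e j i => .path e j (i / s)

/-- The position of the point at time `t` of an edge of the inflation. -/
noncomputable def InflEdge.toPoint (s : ℕ) : InflEdge ι ε → ℝ → InflPoint ι ε
  | link e, t => .link e t
  | seg e j i, t => .path e j ((i + t) / s)

/-- The place of a point of the inflation in a disc drawing. All the paths of an edge lie in the
sector next to its first dart, where the path numbered `j` starts at the angle `δ / (j + 1)` and
returns to the dart at distance `1 / 2` from the centre. The link follows the edge from there. -/
noncomputable def InflPoint.toCoord (δ : ℝ) : InflPoint ι ε → DiscCoord ι ε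
  | orig x => .center x
  | path e j t => .sector (e, false) (t / 2) (δ / (j + 1) * (1 - t))
  | link e t =>
    if t ≤ 1 / 3 then .sector (e, false) (1 / 2 + 3 / 2 * t) 0
    else if 2 / 3 ≤ t then .sector (e, true) (3 - 3 * t) 0
    else .outer e (3 * t - 1)

variable {s p : ℕ}

theorem mapsTo_toCoord {δ : ℝ} (hδ : 0 < δ) :
    Set.MapsTo (InflPoint.toCoord δ) (inflPointSet ι ε) (discCoordSet ι ε δ) := by
  rintro (x | ⟨e, t⟩ | ⟨e, j, t⟩) ht
  · trivial
  · obtain ⟨h0, h1⟩ : t ∈ Set.Ico 0 1 := ht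
    simp only [InflPoint.toCoord]
    split_ifs with h h'
    · exact ⟨⟨by linarith, by linarith⟩, le_rfl, hδ.le⟩
    · exact ⟨⟨by linarith, by linarith⟩, le_rfl, hδ.le⟩
    · exact ⟨by linarith, by linarith⟩
  · obtain ⟨h0, h1⟩ : t ∈ Set.Ioo 0 1 := ht
    have hj : δ / (j + 1) ≤ δ := div_le_self hδ.le (by linarith [j.cast_nonneg (α := ℝ)])
    have hjpos : 0 < δ / (j + 1) := by positivity
    exact ⟨⟨by linarith, by linarith⟩, by nlinarith, by nlinarith⟩

theorem injOn_toCoord {δ : ℝ} (hδ : 0 < δ) :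
    Set.InjOn (InflPoint.toCoord δ) (inflPointSet ι ε) := by
  have hpath {j j' : ℕ} {t : ℝ} (ht : t < 1)
      (h : δ / (j + 1) * (1 - t) = δ / (j' + 1) * (1 - t)) : j = j' := by
    have hdiv := mul_right_cancel₀ (sub_pos.2 ht).ne' h
    field_simp at hdiv
    exact_mod_cast (add_right_cancel hdiv).symm
  rintro (x | ⟨e, t⟩ | ⟨e, j, t⟩) ht (x' | ⟨e', t'⟩ | ⟨e', j', t'⟩) ht' h <;>
    simp only [InflPoint.toCoord] at h
  · grind
  · grind
  · grind
  · grind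
  · obtain ⟨_, _⟩ : t ∈ Set.Ico 0 1 := ht
    obtain ⟨_, _⟩ : t' ∈ Set.Ico 0 1 := ht'
    grind
  · obtain ⟨_, _⟩ : t ∈ Set.Ico 0 1 := ht
    obtain ⟨_, _⟩ : t' ∈ Set.Ioo 0 1 := ht'
    grind
  · grind
  · obtain ⟨_, _⟩ : t ∈ Set.Ioo 0 1 := ht
    obtain ⟨_, _⟩ : t' ∈ Set.Ico 0 1 := ht'
    grind
  · obtain ⟨-, h1⟩ : t ∈ Set.Ioo 0 1 := ht
    simp only [DiscCoord.sector.injEq, Prod.mk.injEq, and_true] at h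
    obtain ⟨rfl, htt', hj⟩ := h
    obtain rfl : t = t' := by linarith
    rw [hpath h1 hj]

theorem mapsTo_vertex_toPoint :
    Set.MapsTo (InflVertex.toPoint s) (inflVertexSet ι ε s p) (inflPointSet ι ε) := by
  rintro (x | e | ⟨e, j, i⟩) hx
  · trivial
  · exact ⟨le_rfl, zero_lt_one⟩
  · obtain ⟨-, h0, hi⟩ : j < p ∧ 0 < i ∧ i < s := hx
    have hs : (0 : ℝ) < s := by exact_mod_cast h0.trans hi
    exact ⟨div_pos (by exact_mod_cast h0) hs, (div_lt_one hs).2 (by exact_mod_cast hi)⟩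

theorem edge_toPoint_mem {f : InflEdge ι ε} (hf : f ∈ inflEdgeSet ι ε s p) {t : ℝ}
    (ht : t ∈ Set.Ioo 0 1) : f.toPoint s t ∈ inflPointSet ι ε := by
  obtain e | ⟨e, j, i⟩ := f
  · exact Set.Ioo_subset_Ico_self ht
  · obtain ⟨-, hi⟩ : j < p ∧ i < s := hf
    have hs : (i + 1 : ℝ) ≤ s := by exact_mod_cast hi
    have hs0 : (0 : ℝ) < s := i.cast_add_one_pos.trans_le hs
    exact ⟨div_pos (by linarith [ht.1, i.cast_nonneg (α := ℝ)]) hs0,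
      (div_lt_one hs0).2 (by linarith [ht.2])⟩

theorem vertex_toPoint_injective (hs : s ≠ 0) :
    Function.Injective (InflVertex.toPoint s : InflVertex ι ε → _) := by
  have hs : (s : ℝ) ≠ 0 := by exact_mod_cast hs
  rintro (x | e | ⟨e, j, i⟩) (y | f | ⟨f, j', i'⟩) h <;>
    simp_all [InflVertex.toPoint, div_left_inj' hs]

theorem floor_natCast_add {i : ℕ} {t : ℝ} (ht : t ∈ Set.Ioo 0 1) : ⌊(i + t : ℝ)⌋₊ = i :=
  (Nat.floor_eq_iff (add_nonneg i.cast_nonneg ht.1.le)).2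
    ⟨le_add_of_nonneg_right ht.1.le, add_lt_add_right ht.2 _⟩

theorem edge_toPoint_ne_vertex (hs : s ≠ 0) (f : InflEdge ι ε) {t : ℝ} (ht : t ∈ Set.Ioo 0 1)
    (x : InflVertex ι ε) : f.toPoint s t ≠ x.toPoint s := by
  have hs : (s : ℝ) ≠ 0 := by exact_mod_cast hs
  obtain e | ⟨e, j, i⟩ := f <;> obtain x | f | ⟨f, j', i'⟩ := x <;>
    simp only [InflEdge.toPoint, InflVertex.toPoint, ne_eq, reduceCtorEq, not_false_eq_true,
      InflPoint.link.injEq, InflPoint.path.injEq, not_and, div_left_inj' hs]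
  · exact fun _ ↦ ht.1.ne'
  · intro _ _ h
    have hfloor := floor_natCast_add (i := i) ht
    rw [h, Nat.floor_natCast] at hfloor
    rw [hfloor] at h
    linarith [ht.1]

theorem edge_toPoint_inj (hs : s ≠ 0) {f g : InflEdge ι ε} {t t' : ℝ} (ht : t ∈ Set.Ioo 0 1)
    (ht' : t' ∈ Set.Ioo 0 1) (h : f.toPoint s t = g.toPoint s t') : f = g ∧ t = t' := by
  have hs : (s : ℝ) ≠ 0 := by exact_mod_cast hs
  obtain e | ⟨e, j, i⟩ := f <;> obtain e' | ⟨e', j', i'⟩ := g <;>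
    simp only [InflEdge.toPoint, reduceCtorEq, InflPoint.link.injEq, InflPoint.path.injEq,
      div_left_inj' hs] at h
  · exact ⟨by rw [h.1], h.2⟩
  · obtain ⟨rfl, rfl, h⟩ := h
    obtain rfl : i = i' := by
      rw [← floor_natCast_add (i := i) ht, h, floor_natCast_add ht']
    exact ⟨rfl, add_left_cancel h⟩

theorem ofEnds_embeddableOn {α β S : Type*} [TopologicalSpace S] {V : Set α} {E : Set β}
    {fst snd : β → α} {h : ∀ e ∈ E, fst e ∈ V ∧ snd e ∈ V} (pt : α → S) (arc : β → C(I, S))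
    (hpt : Set.InjOn pt V) (h0 : ∀ e, arc e 0 = pt (fst e)) (h1 : ∀ e, arc e 1 = pt (snd e))
    (hne : ∀ e ∈ E, ∀ t ∈ Set.Ioo 0 1, ∀ x ∈ V, arc e t ≠ pt x)
    (hinj : ∀ e ∈ E, ∀ f ∈ E, ∀ t ∈ Set.Ioo 0 1, ∀ t' ∈ Set.Ioo 0 1,
      arc e t = arc f t' → e = f ∧ t = t') :
    (ofEnds V E fst snd h).EmbeddableOn S := by
  refine ⟨fun x ↦ pt x, fun e ↦ arc e, fun x y hxy ↦ Subtype.ext (hpt x.2 y.2 hxy), ?_,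
    fun e t ht x ↦ hne e e.2 t ht x x.2, fun e f t ht t' ht' heq ↦ ?_⟩
  · rintro e x y ⟨-, ⟨hx, hy⟩ | ⟨hx, hy⟩⟩
    · simp only [h0, h1, hx, hy]
    · simp only [h0, h1, hx, hy, Sym2.eq_swap]
  · obtain ⟨hef, htt'⟩ := hinj e e.2 f f.2 t ht t' ht' heq
    exact ⟨Subtype.ext hef, htt'⟩

namespace DiscDrawing

variable {a b : ε → ι} {S : Type*} [TopologicalSpace S] (D : DiscDrawing a b S) (δ : ℝ)

/-- The drawing of the inflation that follows the disc drawing of the graph. -/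
noncomputable def inflPoint (c : InflPoint ι ε) : S :=
  D.point (c.toCoord δ)

theorem point_sector_zero (d : ε × Bool) (τ : ℝ) :
    D.point (.sector d 0 τ) = D.point (.center (dartEnd a b d)) := by
  simp [point]

theorem inflPoint_path_zero (e : ε) (j : ℕ) :
    D.inflPoint δ (.path e j 0) = D.inflPoint δ (.orig (a e)) := by
  simp only [inflPoint, InflPoint.toCoord, zero_div, point_sector_zero, dartEnd]

theorem inflPoint_path_one (e : ε) (j : ℕ) :
    D.inflPoint δ (.path e j 1) = D.inflPoint δ (.link e 0) := by
  norm_num [inflPoint, InflPoint.toCoord]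

theorem inflPoint_link_one (e : ε) :
    D.inflPoint δ (.link e 1) = D.inflPoint δ (.orig (b e)) := by
  norm_num [inflPoint, InflPoint.toCoord, point_sector_zero, dartEnd]

theorem inflPoint_pathNode (hs : s ≠ 0) (e : ε) (j i : ℕ) :
    D.inflPoint δ ((pathNode a s e j i).toPoint s) = D.inflPoint δ (.path e j (i / s)) := by
  unfold pathNode
  split_ifs with h0 h1
  · rw [h0, Nat.cast_zero, zero_div, inflPoint_path_zero, InflVertex.toPoint]
  · rw [h1, div_self (Nat.cast_ne_zero.2 hs), inflPoint_path_one, InflVertex.toPoint]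
  · rfl

theorem continuous_point_sector (d : ε × Bool) {r τ : ℝ → ℝ} (hr : Continuous r)
    (hτ : Continuous τ) : Continuous fun t ↦ D.point (.sector d (r t) (τ t)) :=
  (D.continuous_disc _).comp (by fun_prop)

theorem continuous_inflPoint_path (e : ε) (j : ℕ) :
    Continuous fun t ↦ D.inflPoint δ (.path e j t) :=
  D.continuous_point_sector _ (by fun_prop) (by fun_prop)

theorem continuous_inflPoint_link (e : ε) : Continuous fun t ↦ D.inflPoint δ (.link e t) := by
  simp only [inflPoint, InflPoint.toCoord, apply_ite D.point]
  have houter : Continuous fun t : ℝ ↦ D.point (.outer e (3 * t - 1)) :=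
    (D.outer e).continuous_extend.comp (by fun_prop)
  refine (D.continuous_point_sector _ (by fun_prop) (by fun_prop)).if_le
    (Continuous.if_le (D.continuous_point_sector _ (by fun_prop) (by fun_prop)) houter
      continuous_const continuous_id ?_) continuous_id continuous_const ?_
  · rintro t rfl
    norm_num [point, dartEnd]
  · rintro t rfl
    norm_num [point, dartEnd]

variable {D δ}

theorem IsSectorAngle.injOn_inflPoint (hδ : D.IsSectorAngle δ) :
    Set.InjOn (D.inflPoint δ) (inflPointSet ι ε) :=
  hδ.injOn_point.comp (injOn_toCoord hδ.1) (mapsTo_toCoord hδ.1)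

theorem inflate_embeddableOn [Finite ε] (D : DiscDrawing a b S) (hs : s ≠ 0) :
    (inflate a b s p).EmbeddableOn S := by
  obtain ⟨δ, hδ⟩ := D.exists_isSectorAngle
  have hcont (f : InflEdge ι ε) : Continuous fun t : I ↦ D.inflPoint δ (f.toPoint s t) := by
    obtain e | ⟨e, j, i⟩ := f
    · exact (D.continuous_inflPoint_link δ e).comp continuous_subtype_val
    · exact (D.continuous_inflPoint_path δ e j).comp (f := fun t : I ↦ ((i + t) / s : ℝ))
        (by fun_prop)
  refine ofEnds_embeddableOn (fun x ↦ D.inflPoint δ (x.toPoint s)) (fun f ↦ ⟨_, hcont f⟩)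
    (hδ.injOn_inflPoint.comp (vertex_toPoint_injective hs).injOn mapsTo_vertex_toPoint)
    ?_ ?_ ?_ ?_
  · rintro (e | ⟨e, j, i⟩)
    · rfl
    · simp [InflEdge.toPoint, inflFst, D.inflPoint_pathNode δ hs]
  · rintro (e | ⟨e, j, i⟩)
    · exact D.inflPoint_link_one δ e
    · simp [InflEdge.toPoint, inflSnd, D.inflPoint_pathNode δ hs]
  · exact fun f hf t ht x hx h ↦ edge_toPoint_ne_vertex hs f ht x
      (hδ.injOn_inflPoint (edge_toPoint_mem hf ht) (mapsTo_vertex_toPoint hx) h)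
  · intro f hf g hg t ht t' ht' h
    obtain ⟨hfg, htt'⟩ := edge_toPoint_inj hs ht ht'
      (hδ.injOn_inflPoint (edge_toPoint_mem hf ht) (edge_toPoint_mem hg ht') h)
    exact ⟨hfg, Subtype.ext htt'⟩

end DiscDrawing

theorem Presentation.inflate_embeddableOn {α β S : Type*} [TopologicalSpace S] [T2Space S]
    [ChartedSpace (EuclideanSpace ℝ (Fin 2)) S] [Finite ι] [Finite ε] {a b : ε → ι}
    {G : Graph α β} (P : Presentation G a b) (hG : G.Loopless) (hs : s ≠ 0)
    (h : G.EmbeddableOn S) : (inflate a b s p).EmbeddableOn S := by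
  have hab (e : ε) : a e ≠ b e := fun heq ↦ hG.not_isLoopAt _ _ (heq ▸ P.isLink e)
  obtain ⟨D⟩ := P.nonempty_arcDrawing h
  obtain ⟨D'⟩ := D.nonempty_discDrawing hab
  exact D'.inflate_embeddableOn hs

end InflationDrawing

theorem theoremB1 {α : Type u} {β : Type v} (G : Graph α β)
    (hV : V(G).Finite) (hE : E(G).Finite) (hG : G.Loopless) (s : ℕ) (hs : 2 ≤ s) :
    ∃ (V' E' : Type (max u v)) (G' : ℕ → Graph V' E') (k : ℕ),
      -- the graphs `G'(p)`, `p ≥ 1`, are finite, 2-degenerate and 3-colorable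
      (∀ p ≥ 1, V(G' p).Finite ∧ E(G' p).Finite ∧ (G' p).IsDegenerate 2 ∧ (G' p).Colorable 3) ∧
      -- (a) convergence
      (∀ K : Set ℂ, IsCompact K → K ⊆ regionQ s →
        TendstoUniformlyOn
          (fun (p : ℕ) (q : ℂ) ↦
            (cycleFactor s q ^ (k * p))⁻¹ * Polynomial.aeval q (G' p).chromaticPolynomial)
          (fun q ↦ Polynomial.aeval q G.chromaticPolynomial) Filter.atTop K) ∧
      -- (b) connectedness
      (G.IsConnected → ∀ p ≥ 1, (G' p).IsConnected) ∧
      -- (c) bipartiteness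
      (Even s → G.IsBipartite → ∀ p ≥ 1, (G' p).IsBipartite) ∧
      -- (d) embeddability on surfaces
      (∀ (S : Type w) [TopologicalSpace S] [T2Space S] [ChartedSpace (EuclideanSpace ℝ (Fin 2)) S],
        G.EmbeddableOn S → ∀ p ≥ 1, (G' p).EmbeddableOn S) ∧
      -- (i) complex zeros
      (∀ q₀ ∈ regionQ s, Polynomial.aeval q₀ G.chromaticPolynomial = 0 →
        ∀ ε > 0, ∀ᶠ p in Filter.atTop, ∃ q : ℂ, ‖q - q₀‖ < ε ∧
          Polynomial.aeval q (G' p).chromaticPolynomial = 0) ∧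
      -- (ii) real zeros of odd multiplicity
      (∀ q₀ : ℝ, (q₀ : ℂ) ∈ regionQ s →
        Odd ((G.chromaticPolynomial.map (Int.castRingHom ℝ)).rootMultiplicity q₀) →
        ∀ ε > 0, ∀ᶠ p in Filter.atTop, ∃ q ∈ Set.Ioo (q₀ - ε) (q₀ + ε),
          Polynomial.aeval q (G' p).chromaticPolynomial = 0) := by
  have := hV.to_subtype
  have := hE.to_subtype
  have hs0 : s ≠ 0 := by lia
  obtain ⟨a, b, ⟨P⟩⟩ := exists_presentation G
  have hlim := tendstoLocallyUniformlyOn_inflate P hs0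
  have hC (q) (hq : q ∈ regionQ s) : Polynomial.aeval q (closedWalkCount s Polynomial.X) ≠ 0 :=
    aeval_closedWalkCount s q ▸ closedWalkCount_ne_zero hq
  refine ⟨_, _, inflate a b s, E(G).ncard,
    fun p _ ↦ ⟨inflate_vertexSet_finite a b s p, inflate_edgeSet_finite a b s p,
      inflate_isDegenerate_two hs, inflate_colorable_three⟩,
    fun K hKs hK ↦ ?_,
    fun hconn p hp ↦ inflate_isConnected P hs0 (Nat.ne_of_gt hp) hconn,
    fun heven hbip p _ ↦ inflate_isBipartite P heven hbip,
    fun S _ _ _ hemb p _ ↦ P.inflate_embeddableOn hG hs0 hemb,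
    fun q₀ hq₀ h0 ε hε ↦ eventually_exists_root_near (isOpen_regionQ s) hC
      (chromaticPolynomial_ne_zero hV hE hG) hlim hq₀ h0 hε,
    fun q₀ hq₀ hodd ε hε ↦ eventually_exists_real_root_near (isOpen_regionQ s) hC hlim hq₀ hodd hε⟩
  refine ((tendstoLocallyUniformlyOn_iff_forall_isCompact (isOpen_regionQ s)).1 hlim K hK hKs).congr
    (.of_forall fun p q hq ↦ ?_)
  have hq0 : q ≠ 0 := ne_of_mem_of_not_mem (hK hq) zero_notMem_regionQ
  simp only [cycleFactor_eq hq0, aeval_closedWalkCount]
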